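/- **Setting.** Let $0\le N\le n$, $M\ge 1$, $L\ge1$, $K\ge 0$ be integers, $a>0$, $x_0\in\mathbb R$. Let $\rho,\lambda:(x_0,\infty)\to\mathbb C\setminus\{0\}$, let $d_1,\dots,d_n\in\mathbb C$ be such that $d_1,\dots,d_N$ are distinct, $d_{N+1},\dots,d_n$ are distinct and, if $N<n$, $d_1,\dots,d_N\neq0$. Consider $$Z_1'=\rho(\Lambda_1+R_1)Z_1,\quad \Lambda_1=\Lambda_0+\Phi_1,\quad \Lambda_0=\mathrm{dg}(\lambda d_1,\dots,\lambda d_N,d_{N+1},\dots,d_n),\quad R_1=V_{11}+\dots+V_{M-1,1}+E_1,$$ where $\Phi_1=\mathrm{dg}(\tilde\Delta_1,\Delta_1)$ is diagonal (blocks of sizes $N$ and $n-N$), $\mathrm{dg}\,V_{11}=0$ and, as $x\to\infty$, $$V_{j1}=O(x^{-ja}),\ E_1=O(x^{-Ma}),\ 1/\rho=O(x^{1-Ka}),\ 1/\lambda=O(x^{-La}),\ \tilde\Delta_1=\tilde D_1+O(x^{-a}),\ \Delta_1=O(x^{-a}),$$ with $\tilde D_1$ a constant diagonal matrix. $E_1$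 is continuous; $V_{j1}$, $1/\lambda$ are respectively $M-j$, $M-1$ times, and $1/\rho,\tilde\Delta_1,\Delta_1$ are $\max(M-2,0)$ times continuously differentiable on $(x_0,\infty)$, and these estimates (except that for $E_1$) may be differentiated that many times, each differentiation lowering the exponent of $x$ by $1$. **The process.** Given $\Phi_m=\mathrm{dg}(\tilde\Delta_m,\Delta_m)$, $R_m=V_{1m}+\dots+V_{M-m,m}+E_m$ and $\Lambda_m=\Lambda_0+\Phi_m$ ($1\le m\le M-1$), let $v_{ij}$ be the entries of $V_{1m}$ and define $P_m=(p_{ij})$ by $p_{ii}=0$ and, for $i\ne j$, $$p_{ij}=\begin{cases}v_{ij}/\{\lambda(d_j-d_i)\}&i,j\le N\\-v_{ij}/(\lambda d_i)&i\le N<j\\v_{ij}/(\lambda d_j)&j\le N<i\\v_{ij}/(d_j-d_i)&i,j>N,\ K\ge1\\v_{ij}/(d_j-d_i-ma)&i,j>N,\ K=0.\end{cases}$$ Let $Q_m$ be the lower right block ($i,j>N$) of $P_m$ (zeros elsewhere) and $\tilde Q_m=P_m-Q_m$. Let $U_m$ have entries $\lambda^{-1}(d_j/d_i)v_{ij}$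 for $i\le N<j$, $\lambda^{-1}(d_i/d_j)v_{ij}$ for $j\le N<i$, and $0$ otherwise; with $[A,B]=AB-BA$ put $\bar T_m=[\mathrm{dg}(\tilde\Delta_m,0),\tilde Q_m]$, $\tilde T_m=[\mathrm{dg}(0,\Delta_m),\tilde Q_m]$, $T_m=[\mathrm{dg}(0,\Delta_m),Q_m]$. Assign the orders (exponents of $x^{-a}$): $-\rho^{-1}Q_m'$: $m+K$ (term omitted if $K=0$); $-\rho^{-1}\tilde Q_m'$: $m+K+L$; $U_m,\bar T_m$: $m+L$; $\tilde T_m$: $m+L+1$; $T_m$: $m+1$; $V_{jm}$ ($2\le j\le M-m$): $m+j-1$; $V_{jm}Q_m$ and $V_{jm}\tilde Q_m$ ($1\le j\le M-m$): $2m+j-1$ and $2m+j-1+L$; and let a factor $(-P_m)^r$ add $rm$. For $m+1\le k\le M-1$ let $C_k$ be the sum of all the $(-P_m)^rU$, $r\ge0$, $U$ in this list, of order $k$; for $k\ge M$ put $C_k=0$. Then $\Phi_{m+1}=\Phi_m+\mathrm{dg}\,C_{m+1}$, $V_{1,m+1}=C_{m+1}-\mathrm{dg}\,C_{m+1}$,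 $V_{j,m+1}=C_{m+j}$ ($j\ge2$), and $E_{m+1}$ is what remains, i.e. $R_{m+1}=V_{1,m+1}+\dots+V_{M-m-1,m+1}+E_{m+1}$ where $$\Lambda_{m+1}+R_{m+1}=\Lambda_m+(I+P_m)^{-1}\{-\rho^{-1}P_m'+V_{1m}+\Lambda_mP_m-P_m\Lambda_m+(R_m-V_{1m})+R_mP_m\}.$$ If $K=0$, assume in addition that $\rho(x)=x^{-1}$ and that, for $1\le m\le M-1$ and $i,j>N$, the $(i,j)$ entry of $V_{1m}$ is $c_{ij}x^{-ma}$ with a constant $c_{ij}$ (depending on $m$), and $ma\neq d_j-d_i$. **Conclusions.** (i) For $1\le m\le M-1$: $\mathrm{dg}\,V_{1m}=0$; $V_{jm}=O(x^{-(m+j-1)a})$ for $1\le j\le M-m$; $P_m=O(x^{-ma})$, and $I+P_m(x)$ is invertible for all large $x$; on $(x_0,\infty)$ $$-\rho^{-1}P_m'+V_{1m}+\Lambda_mP_m-P_m\Lambda_m=-\epsilon\rho^{-1}Q_m'-\rho^{-1}\tilde Q_m'+U_m+\bar T_m+\tilde T_m+T_m,$$ with $\epsilon=1$ if $K\ge1$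 and $\epsilon=0$ if $K=0$; moreover $\rho^{-1}P_m'=O(x^{-(m+K)a})$, $\rho^{-1}\tilde Q_m'=O(x^{-(m+K+L)a})$, $U_m,\bar T_m=O(x^{-(m+L)a})$, $\tilde T_m=O(x^{-(m+L+1)a})$, $T_m=O(x^{-(m+1)a})$. (ii) For $1\le m\le M$: $E_m=O(x^{-Ma})$, $\tilde\Delta_m=\tilde D_1+O(x^{-a})$, $\Delta_m=O(x^{-a})$. Further $R_M=E_M$. (iii) If $1\le m\le M-1$, $X>x_0$ and $I+P_m$ is invertible on $[X,\infty)$, then on $[X,\infty)$ the function $Z_m=(I+P_m)Z_{m+1}$ solves $Z_m'=\rho(\Lambda_m+R_m)Z_m$ if and only if $Z_{m+1}$ solves $Z_{m+1}'=\rho(\Lambda_{m+1}+R_{m+1})Z_{m+1}$. (iv) Write $\Phi_M=\mathrm{dg}(\delta_1,\dots,\delta_n)$ and $\mu_k=\lambda d_k+\delta_k$ for $k\le N$, $\mu_k=d_k+\delta_k$ for $k>N$. Let $X>x_0$ be such that $I+P_1,\dots,I+P_{M-1}$ are invertible on $[X,\infty)$, $\rho R_M\in L(X,\infty)$ and, for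 all $j,k$, $\mathrm{Re}\,F_{jk}$ with $F_{jk}=\rho(\mu_j-\mu_k)$ has constant sign ($\le0$ or $\ge0$) on $[X,\infty)$. Then for each $k$ there is $\eta_k$ with $\eta_k(x)\to0$ as $x\to\infty$ such that $$Z_{Mk}(x)=\{e_k+\eta_k(x)\}\exp\Big(\int_X^x\rho(t)\mu_k(t)\,dt\Big)$$ solves $Z_M'=\rho(\Lambda_M+R_M)Z_M$ on $[X,\infty)$ and $(I+P_1)(I+P_2)\cdots(I+P_{M-1})Z_{Mk}$ solves the original system on $[X,\infty)$. If in addition, for all $j\ne k$, either $\left|\int_X^\infty\mathrm{Re}\,F_{jk}\,dx\right|=\infty$ or $\mathrm{Re}\,F_{jk}\equiv0$ on $[X,\infty)$, and if $nI_X<1$ where $I_X=\int_X^\infty|\rho|\,\|R_M\|\,dt$, $\|R_M\|=\max_{i,j}|r_{ijM}|$, then $\eta_k$ can be chosen with, moreover, $|\eta_k(x)|\le I_X/(1-nI_X)$ for all $x\ge X$, where $|\cdot|$ is the maximum norm. -/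

import Mathlib

open Filter Topology Asymptotics MeasureTheory Set

noncomputable section

namespace LevinsonAlg

/-- The data of a system `Z' = ρ (Λ₀ + Φ₁ + R₁) Z` on `(x₀, ∞)`, where
`Λ₀ = dg (lam d₁, …, lam d_N, d_{N+1}, …, d_n)`, `Φ₁ = dg φ` and
`R₁ = V 1 + ⋯ + V (M - 1) + E`. The indices `1, …, N` are the `i : Fin n` with `i.val < N`.
The numbers `M`, `K`, `L`, `a` and the constants `D₁` describe the orders of magnitude. -/
structure System (n : ℕ) where
  (N M K L : ℕ)
  (a x₀ : ℝ)
  (d D₁ : Fin n → ℂ)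
  (ρ lam : ℝ → ℂ)
  φ : ℝ → Fin n → ℂ
  V : ℕ → ℝ → Matrix (Fin n) (Fin n) ℂ
  E : ℝ → Matrix (Fin n) (Fin n) ℂ

/-- The data carried from one step of the process to the next, at step `m`: the diagonal
`Φ_m = dg φ`, the perturbation terms `V_{jm} = V j` for `1 ≤ j ≤ M - m`, and the remainder
`E_m = E`. -/
structure Stage (n : ℕ) where
  φ : ℝ → Fin n → ℂ
  V : ℕ → ℝ → Matrix (Fin n) (Fin n) ℂ
  E : ℝ → Matrix (Fin n) (Fin n) ℂ

/-- `f = O(x^σ)` on `(x₀, ∞)`, and this may be differentiated `k` times, each differentiation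
reducing the power of `x` by one. -/
def DiffO (x₀ : ℝ) (k : ℕ) (σ : ℝ) (f : ℝ → ℂ) : Prop :=
  ContDiffOn ℝ k f (Ioi x₀) ∧
    ∀ i ≤ k, iteratedDeriv i f =O[atTop] fun x : ℝ => x ^ (σ - i)

/-- `F(x) = O(x^σ)` as `x → ∞`, for a matrix function `F`. -/
def MatO {n : ℕ} (σ : ℝ) (F : ℝ → Matrix (Fin n) (Fin n) ℂ) : Prop :=
  ∀ i j, (fun x => F x i j) =O[atTop] fun x : ℝ => x ^ σ

/-- The entrywise derivative of a matrix function. -/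
def matDeriv {n : ℕ} (F : ℝ → Matrix (Fin n) (Fin n) ℂ) (x : ℝ) : Matrix (Fin n) (Fin n) ℂ :=
  Matrix.of fun i j => deriv (fun t => F t i j) x

/-- `max |a_ij|`. -/
def maxNorm {n : ℕ} (A : Matrix (Fin n) (Fin n) ℂ) : ℝ :=
  ‖fun p : Fin n × Fin n => A p.1 p.2‖

/-- `Z` solves `Z' = A Z` on `[X, ∞)`. -/
def IsSolution {n : ℕ} (A : ℝ → Matrix (Fin n) (Fin n) ℂ) (X : ℝ) (Z : ℝ → Fin n → ℂ) : Prop :=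
  ∀ x ∈ Ici X, HasDerivWithinAt Z ((A x).mulVec (Z x)) (Ici X) x

namespace System

variable {n : ℕ} (s : System n)

/-- The diagonal entries of `Λ₀`. -/
def Λ₀ (x : ℝ) (i : Fin n) : ℂ := if i.val < s.N then s.lam x * s.d i else s.d i

/-- The limit of `Φ₁`: the constant `D̃₁` in the first block and `0` in the second one. -/
def φlim (i : Fin n) : ℂ := if i.val < s.N then s.D₁ i else 0

/-- The standing assumptions on the system: the structure of `Λ₀`, the order estimates and their
derivatives. -/
structure Admissible : Prop where
  N_le : s.N ≤ n
  one_le_M : 1 ≤ s.M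
  one_le_L : 1 ≤ s.L
  a_pos : 0 < s.a
  d_inj_fst : ∀ i j : Fin n, i.val < s.N → j.val < s.N → s.d i = s.d j → i = j
  d_inj_snd : ∀ i j : Fin n, s.N ≤ i.val → s.N ≤ j.val → s.d i = s.d j → i = j
  d_ne_zero : s.N < n → ∀ i : Fin n, i.val < s.N → s.d i ≠ 0
  ρ_ne_zero : ∀ x > s.x₀, s.ρ x ≠ 0
  lam_ne_zero : ∀ x > s.x₀, s.lam x ≠ 0
  V_diag : 2 ≤ s.M → ∀ x > s.x₀, ∀ i, s.V 1 x i i = 0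
  V_order : ∀ j, 1 ≤ j → j ≤ s.M - 1 → ∀ p q,
    DiffO s.x₀ (s.M - j) (-(j * s.a)) fun x => s.V j x p q
  E_cont : ∀ p q, ContinuousOn (fun x => s.E x p q) (Ioi s.x₀)
  E_order : MatO (-(s.M * s.a)) s.E
  ρ_order : DiffO s.x₀ (s.M - 2) (1 - s.K * s.a) fun x => (s.ρ x)⁻¹
  lam_order : DiffO s.x₀ (s.M - 1) (-(s.L * s.a)) fun x => (s.lam x)⁻¹
  φ_order : ∀ i, DiffO s.x₀ (s.M - 2) (-s.a) fun x => s.φ x i - s.φlim i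

/-! ### One step of the process -/

/-- The matrix `P_m`, in terms of the matrix `V_{1m}`. The last denominator is modified in the
case `K = 0`. -/
def Pmat (m : ℕ) (t : Stage n) (x : ℝ) : Matrix (Fin n) (Fin n) ℂ :=
  Matrix.of fun i j =>
    if i = j then 0
    else if i.val < s.N then
      if j.val < s.N then t.V 1 x i j / (s.lam x * (s.d j - s.d i))
      else -t.V 1 x i j / (s.lam x * s.d i)
    else
      if j.val < s.N then t.V 1 x i j / (s.lam x * s.d j)
      else if s.K = 0 then t.V 1 x i j / (s.d j - s.d i - (m * s.a : ℝ))
      else t.V 1 x i j / (s.d j - s.d i)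

/-- `Q_m`: the entries of `P_m` that do not involve `lam` (the lower right block). -/
def Qmat (m : ℕ) (t : Stage n) (x : ℝ) : Matrix (Fin n) (Fin n) ℂ :=
  Matrix.of fun i j => if s.N ≤ i.val ∧ s.N ≤ j.val then s.Pmat m t x i j else 0

/-- `Q̃_m`: the entries of `P_m` that involve `lam`. -/
def Qtmat (m : ℕ) (t : Stage n) (x : ℝ) : Matrix (Fin n) (Fin n) ℂ :=
  Matrix.of fun i j => if s.N ≤ i.val ∧ s.N ≤ j.val then 0 else s.Pmat m t x i j

/-- The matrix `U_m`. -/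
def Umat (t : Stage n) (x : ℝ) : Matrix (Fin n) (Fin n) ℂ :=
  Matrix.of fun i j =>
    if i.val < s.N ∧ s.N ≤ j.val then (s.lam x)⁻¹ * (s.d j / s.d i) * t.V 1 x i j
    else if s.N ≤ i.val ∧ j.val < s.N then (s.lam x)⁻¹ * (s.d i / s.d j) * t.V 1 x i j
    else 0

/-- `dg (Δ̃_m, 0)`. -/
def Δfst (t : Stage n) (x : ℝ) : Matrix (Fin n) (Fin n) ℂ :=
  Matrix.diagonal fun i => if i.val < s.N then t.φ x i else 0

/-- `dg (0, Δ_m)`. -/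
def Δsnd (t : Stage n) (x : ℝ) : Matrix (Fin n) (Fin n) ℂ :=
  Matrix.diagonal fun i => if i.val < s.N then 0 else t.φ x i

/-- `T̄_m`. -/
def Tbar (m : ℕ) (t : Stage n) (x : ℝ) : Matrix (Fin n) (Fin n) ℂ :=
  s.Δfst t x * s.Qtmat m t x - s.Qtmat m t x * s.Δfst t x

/-- `T̃_m`. -/
def Ttil (m : ℕ) (t : Stage n) (x : ℝ) : Matrix (Fin n) (Fin n) ℂ :=
  s.Δsnd t x * s.Qtmat m t x - s.Qtmat m t x * s.Δsnd t x

/-- `T_m`. -/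
def Tmat (m : ℕ) (t : Stage n) (x : ℝ) : Matrix (Fin n) (Fin n) ℂ :=
  s.Δsnd t x * s.Qmat m t x - s.Qmat m t x * s.Δsnd t x

/-- `Λ_m = Λ₀ + Φ_m`. -/
def Λmat (t : Stage n) (x : ℝ) : Matrix (Fin n) (Fin n) ℂ :=
  Matrix.diagonal fun i => s.Λ₀ x i + t.φ x i

/-- `R_m = V_{1m} + ⋯ + V_{M-m,m} + E_m`. -/
def Rmat (m : ℕ) (t : Stage n) (x : ℝ) : Matrix (Fin n) (Fin n) ℂ :=
  ∑ j ∈ Finset.Icc 1 (s.M - m), t.V j x + t.E x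

/-- The coefficient matrix in braces, multiplied by `(I + P_m)⁻¹`, of the system for `Z_{m+1}`
that `Z_m = (I + P_m) Z_{m+1}` gives; the factor `ρ` is taken out. -/
def transformed (m : ℕ) (t : Stage n) (x : ℝ) : Matrix (Fin n) (Fin n) ℂ :=
  s.Λmat t x + (1 + s.Pmat m t x)⁻¹ *
    (-((s.ρ x)⁻¹ • matDeriv (s.Pmat m t) x) + t.V 1 x
      + s.Λmat t x * s.Pmat m t x - s.Pmat m t x * s.Λmat t x
      + (s.Rmat m t x - t.V 1 x) + s.Rmat m t x * s.Pmat m t x)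

/-- The sum of those of the terms
`-ρ⁻¹ Q_m'` (only if `K ≠ 0`), `-ρ⁻¹ Q̃_m'`, `U_m`, `T̄_m`, `T̃_m`, `T_m`, `V_{jm}` (`j ≥ 2`),
`V_{jm} Q_m` and `V_{jm} Q̃_m` whose order of magnitude is `x^{-k a}`. -/
def baseTerm (m : ℕ) (t : Stage n) (k : ℕ) (x : ℝ) : Matrix (Fin n) (Fin n) ℂ :=
  (if s.K ≠ 0 ∧ k = m + s.K then -((s.ρ x)⁻¹ • matDeriv (s.Qmat m t) x) else 0)
  + (if k = m + s.K + s.L then -((s.ρ x)⁻¹ • matDeriv (s.Qtmat m t) x) else 0)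
  + (if k = m + s.L then s.Umat t x + s.Tbar m t x else 0)
  + (if k = m + s.L + 1 then s.Ttil m t x else 0)
  + (if k = m + 1 then s.Tmat m t x else 0)
  + ∑ j ∈ Finset.Icc 2 (s.M - m), (if k + 1 = m + j then t.V j x else 0)
  + ∑ j ∈ Finset.Icc 1 (s.M - m),
      ((if k + 1 = 2 * m + j then t.V j x * s.Qmat m t x else 0)
        + (if k + 1 = 2 * m + j + s.L then t.V j x * s.Qtmat m t x else 0))

/-- The terms of order `x^{-k a}` collated after expanding `(I + P_m)⁻¹` as a geometric series;
`(-P_m)^r` counts as a factor of order `x^{-r m a}`. Terms of the order `x^{-M a}` of the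
prescribed accuracy are not collated and remain in `E_{m+1}`. -/
def collated (m : ℕ) (t : Stage n) (k : ℕ) (x : ℝ) : Matrix (Fin n) (Fin n) ℂ :=
  if k < s.M then
    ∑ r ∈ Finset.range (k + 1),
      (if r * m ≤ k then (-s.Pmat m t x) ^ r * s.baseTerm m t (k - r * m) x else 0)
  else 0

/-- `Φ_{m+1} = Φ_m + dg S_{m+1}`, where `S_{m+1}` is the dominant collated term. -/
def nextφ (m : ℕ) (t : Stage n) (x : ℝ) (i : Fin n) : ℂ :=
  t.φ x i + s.collated m t (m + 1) x i i

/-- `V_{1,m+1} = S_{m+1} - dg S_{m+1}`, and `V_{j,m+1}` is the term of order `x^{-(m+j) a}`. -/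
def nextV (m : ℕ) (t : Stage n) (j : ℕ) (x : ℝ) : Matrix (Fin n) (Fin n) ℂ :=
  if j = 1 then
    s.collated m t (m + 1) x - Matrix.diagonal fun i => s.collated m t (m + 1) x i i
  else s.collated m t (m + j) x

/-- The passage from step `m` to step `m + 1`: the remainder `E_{m+1}` is what is left of the
exact transformed coefficient matrix. -/
def next (m : ℕ) (t : Stage n) : Stage n where
  φ := s.nextφ m t
  V := s.nextV m t
  E := fun x => s.transformed m t x
    - Matrix.diagonal (fun i => s.Λ₀ x i + s.nextφ m t x i)
    - ∑ j ∈ Finset.Icc 1 (s.M - (m + 1)), s.nextV m t j x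

/-- The data `Φ_m`, `V_{jm}`, `E_m` for `m = 1, 2, …`; the value at `m = 0` plays no role. -/
def stage : ℕ → Stage n
  | 0 => ⟨s.φ, s.V, s.E⟩
  | m + 1 => if m = 0 then ⟨s.φ, s.V, s.E⟩ else s.next m (stage m)

/-- `P_m` -/
def P (m : ℕ) (x : ℝ) : Matrix (Fin n) (Fin n) ℂ := s.Pmat m (s.stage m) x

/-- `Λ_m` -/
def Λ (m : ℕ) (x : ℝ) : Matrix (Fin n) (Fin n) ℂ := s.Λmat (s.stage m) x

/-- `R_m` -/
def R (m : ℕ) (x : ℝ) : Matrix (Fin n) (Fin n) ℂ := s.Rmat m (s.stage m) x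

/-- The coefficient matrix `ρ (Λ_m + R_m)` of the system for `Z_m`. -/
def coeff (m : ℕ) (x : ℝ) : Matrix (Fin n) (Fin n) ℂ := s.ρ x • (s.Λ m x + s.R m x)

/-- `(I + P_1) (I + P_2) ⋯ (I + P_{M-1})` -/
def prodP (x : ℝ) : Matrix (Fin n) (Fin n) ℂ :=
  ((List.range (s.M - 1)).map fun m => 1 + s.P (m + 1) x).prod

/-- The additional assumptions in the case `K = 0`: `ρ = 1 / x`, the lower right entries of each
`V_{1m}` are `c_ij x^{-m a}`, and the modified denominators do not vanish. -/
structure InverseFactor : Prop where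
  ρ_eq : ∀ x > s.x₀, s.ρ x = ((x⁻¹ : ℝ) : ℂ)
  V_block : ∀ m, 1 ≤ m → m ≤ s.M - 1 → ∀ i j : Fin n, s.N ≤ i.val → s.N ≤ j.val →
    ∃ c : ℂ, ∀ x > s.x₀, (s.stage m).V 1 x i j = c * ((x ^ (-(m * s.a)) : ℝ) : ℂ)
  nonresonant : ∀ m : ℕ, 1 ≤ m → m ≤ s.M - 1 → ∀ i j : Fin n, s.N ≤ i.val → s.N ≤ j.val →
    ((m * s.a : ℝ) : ℂ) ≠ s.d j - s.d i

/-- The diagonal entry `ρ (lam d_k + δ_k)` or `ρ (d_k + δ_k)` of `ρ Λ_M`. -/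
def expo (k : Fin n) (x : ℝ) : ℂ := s.ρ x * (s.Λ₀ x k + (s.stage s.M).φ x k)

/-- The function `F`, for the pair of indices `j`, `k`. -/
def F (j k : Fin n) (x : ℝ) : ℂ := s.expo j x - s.expo k x

/-- The sign condition on `[X, ∞)`. -/
def Dichotomy (X : ℝ) : Prop :=
  ∀ j k, (∀ x ≥ X, (s.F j k x).re ≤ 0) ∨ (∀ x ≥ X, 0 ≤ (s.F j k x).re)

/-- For all `j ≠ k`, either `|∫_X^∞ Re F| = ∞` or `Re F` is identically zero on `[X, ∞)`. -/
def Divergent (X : ℝ) : Prop :=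
  ∀ j k, j ≠ k →
    Tendsto (fun x => |∫ t in X..x, (s.F j k t).re|) atTop atTop ∨
      ∀ x ≥ X, (s.F j k x).re = 0

/-- `{e_k + η(x)} exp (∫_X^x ρ (lam d_k + δ_k) dt)`, with `lam d_k` replaced by `d_k` for
`k > N`. -/
def levinsonForm (X : ℝ) (k : Fin n) (η : ℝ → Fin n → ℂ) (x : ℝ) : Fin n → ℂ :=
  Complex.exp (∫ t in X..x, s.expo k t) • (Pi.single k 1 + η x)

/-- `∫_X^∞ |ρ| ‖R_M‖ dt` -/
def errorIntegral (X : ℝ) : ℝ := ∫ t in Ioi X, ‖s.ρ t‖ * maxNorm (s.R s.M t)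

end System

end LevinsonAlg

end

namespace LevinsonAlg

/-! One step of the process is a near-diagonalisation. `P_m` solves the equation `V_{1m} + Λ_m P - P
Λ_m = 0` up to terms of higher order: the parts of `Λ_m` that it ignores are small relative to `λ`,
or are commutators with `Φ_m`, and in `ρ⁻¹ P_m'` the power of `x` lost by differentiation is
regained from `1/ρ = O(x^{1-Ka})`. For `K = 0` that last gain is nil on the lower right block, but
there the entries are multiples of `x^{-ma}`, on which `x d/dx` acts as the scalar `-ma`; the
shifted denominator absorbs it (`dominant_removed`).

The induction closes because order `k` always comes with `M - k` derivatives (`HasOrder`): whenever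
a derivative is consumed, the order rises by at least one. This is `baseTerm_order`,
`collated_order` and `StageOrder.next`. For the remainder, `(I + P_m)⁻¹` is replaced by a finite
geometric sum with exact error term; after the collated orders below `M` are removed, everything
left is `O(x^{-Ma})` (`next_E_order`).

The asymptotic solutions come from Levinson's method. Putting `Z = (e_k + η) exp ∫ ρ μ_k` gives
`η_j' = F_jk η_j + (ρ R_M (e_k + η))_j`. Each scalar equation is inverted by variation of constants,
integrating from the left end point when the kernel decays and from infinity otherwise
(`isVariation_forward`, `isVariation_backward`), and `η` is the fixed point of a contraction
(`exists_levinson_of_isVariation`). Without the divergence condition the contraction is available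
only on some `[Y, ∞)`, and the solution is then continued back to `X` (`exists_isSolution_extend`).
-/

theorem isBigO_rpow_mono {σ τ : ℝ} (h : σ ≤ τ) :
    (fun x : ℝ => x ^ σ) =O[atTop] fun x : ℝ => x ^ τ := by
  refine IsBigO.of_bound 1 ?_
  filter_upwards [eventually_ge_atTop 1] with x hx
  have h0 : (0 : ℝ) ≤ x := by linarith
  rw [Real.norm_of_nonneg (Real.rpow_nonneg h0 _), Real.norm_of_nonneg (Real.rpow_nonneg h0 _),
    one_mul]
  exact Real.rpow_le_rpow_of_exponent_le hx h

theorem isBigO_rpow_mul {f g : ℝ → ℂ} {σ τ υ : ℝ} (hf : f =O[atTop] fun x : ℝ => x ^ σ)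
    (hg : g =O[atTop] fun x : ℝ => x ^ τ) (h : σ + τ ≤ υ) :
    (fun x => f x * g x) =O[atTop] fun x : ℝ => x ^ υ := by
  refine ((hf.mul hg).congr' EventuallyEq.rfl ?_).trans (isBigO_rpow_mono h)
  filter_upwards [eventually_gt_atTop 0] with x hx
  rw [Real.rpow_add hx]

/-! ### The calculus of `DiffO` -/

namespace DiffO

variable {x₀ : ℝ} {k l : ℕ} {σ τ : ℝ} {f g : ℝ → ℂ}

theorem isBigO (hf : DiffO x₀ k σ f) : f =O[atTop] fun x : ℝ => x ^ σ := by
  simpa using hf.2 0 (Nat.zero_le k)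

theorem continuousOn (hf : DiffO x₀ k σ f) : ContinuousOn f (Ioi x₀) := hf.1.continuousOn

theorem differentiableAt (hf : DiffO x₀ k σ f) (hk : 1 ≤ k) {x : ℝ} (hx : x₀ < x) :
    DifferentiableAt ℝ f x :=
  (hf.1.contDiffAt (Ioi_mem_nhds hx)).differentiableAt (by
    have : k ≠ 0 := by omega
    exact_mod_cast this)

theorem mono (hf : DiffO x₀ k σ f) (hl : l ≤ k) (hσ : σ ≤ τ) : DiffO x₀ l τ f :=
  ⟨hf.1.of_le (by exact_mod_cast hl), fun i hi =>
    (hf.2 i (hi.trans hl)).trans (isBigO_rpow_mono (by linarith))⟩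

theorem congr (hf : DiffO x₀ k σ f) (h : EqOn g f (Ioi x₀)) : DiffO x₀ k σ g := by
  refine ⟨hf.1.congr h, fun i hi => (hf.2 i hi).congr' ?_ EventuallyEq.rfl⟩
  filter_upwards [eventually_gt_atTop x₀] with x hx
  exact ((h.iteratedDeriv_of_isOpen isOpen_Ioi i) hx).symm

theorem const (c : ℂ) : DiffO x₀ k 0 fun _ => c := by
  refine ⟨contDiffOn_const, fun i _ => ?_⟩
  have h : iteratedDeriv i (fun _ : ℝ => c) = fun _ => if i = 0 then c else 0 :=
    funext fun x => iteratedDeriv_const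
  rw [h]
  split_ifs with h
  · subst h
    simpa using isBigO_const_const c (one_ne_zero (α := ℝ)) atTop
  · exact isBigO_zero _ _

theorem zero : DiffO x₀ k σ fun _ => 0 := by
  refine ⟨contDiffOn_const, fun i _ => ?_⟩
  have h : iteratedDeriv i (fun _ : ℝ => (0 : ℂ)) = fun _ => 0 :=
    funext fun x => iteratedDeriv_fun_const_zero
  rw [h]
  exact isBigO_zero _ _

theorem add (hf : DiffO x₀ k σ f) (hg : DiffO x₀ k σ g) :
    DiffO x₀ k σ fun x => f x + g x := by
  refine ⟨hf.1.add hg.1, fun i hi => ?_⟩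
  refine ((hf.2 i hi).add (hg.2 i hi)).congr' ?_ EventuallyEq.rfl
  filter_upwards [eventually_gt_atTop x₀] with x hx
  have hle : (i : WithTop ℕ∞) ≤ k := by exact_mod_cast hi
  exact (iteratedDeriv_fun_add ((hf.1.contDiffAt (Ioi_mem_nhds hx)).of_le hle)
    ((hg.1.contDiffAt (Ioi_mem_nhds hx)).of_le hle)).symm

theorem mul (hf : DiffO x₀ k σ f) (hg : DiffO x₀ k τ g) :
    DiffO x₀ k (σ + τ) fun x => f x * g x := by
  refine ⟨hf.1.mul hg.1, fun i hi => ?_⟩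
  have key : (fun x => ∑ j ∈ Finset.range (i + 1),
      (i.choose j : ℂ) * iteratedDeriv j f x * iteratedDeriv (i - j) g x)
      =O[atTop] fun x : ℝ => x ^ (σ + τ - i) := by
    refine IsBigO.fun_sum fun j hj => ?_
    have hj : j ≤ i := by simpa [Nat.lt_succ_iff] using hj
    refine isBigO_rpow_mul ((hf.2 j (by omega)).const_mul_left _) (hg.2 (i - j) (by omega)) ?_
    push_cast [hj]
    linarith
  refine key.congr' ?_ EventuallyEq.rfl
  filter_upwards [eventually_gt_atTop x₀] with x hx
  have hle : (i : WithTop ℕ∞) ≤ k := by exact_mod_cast hi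
  exact (iteratedDeriv_fun_mul ((hf.1.contDiffAt (Ioi_mem_nhds hx)).of_le hle)
    ((hg.1.contDiffAt (Ioi_mem_nhds hx)).of_le hle)).symm

theorem const_mul (c : ℂ) (hf : DiffO x₀ k σ f) : DiffO x₀ k σ fun x => c * f x := by
  simpa using (const c).mul hf

theorem neg (hf : DiffO x₀ k σ f) : DiffO x₀ k σ fun x => -f x := by
  simpa using hf.const_mul (-1)

theorem sub (hf : DiffO x₀ k σ f) (hg : DiffO x₀ k σ g) :
    DiffO x₀ k σ fun x => f x - g x := by
  simpa [sub_eq_add_neg] using hf.add hg.neg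

theorem sum {ι : Type*} {s : Finset ι} {f : ι → ℝ → ℂ} (h : ∀ i ∈ s, DiffO x₀ k σ (f i)) :
    DiffO x₀ k σ fun x => ∑ i ∈ s, f i x := by
  classical
  induction s using Finset.induction_on with
  | empty => simpa using zero
  | insert a s ha ih =>
    simp only [Finset.sum_insert ha]
    exact (h a (by simp)).add (ih fun i hi => h i (by simp [hi]))

theorem deriv (hf : DiffO x₀ (k + 1) σ f) : DiffO x₀ k (σ - 1) (deriv f) := by
  constructor
  · have h := hf.1
    rw [show ((k + 1 : ℕ) : WithTop ℕ∞) = (k : WithTop ℕ∞) + 1 by push_cast; rfl,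
      contDiffOn_succ_iff_deriv_of_isOpen isOpen_Ioi] at h
    exact h.2.2
  · intro i hi
    have h := hf.2 (i + 1) (by omega)
    rw [iteratedDeriv_succ'] at h
    convert h using 3
    push_cast
    ring

end DiffO

/-- The entries of `F` are `O(x^σ)`, with `k` differentiations. -/
def MatDiffO {n : ℕ} (x₀ : ℝ) (k : ℕ) (σ : ℝ) (F : ℝ → Matrix (Fin n) (Fin n) ℂ) : Prop :=
  ∀ i j, DiffO x₀ k σ fun x => F x i j

namespace MatDiffO

variable {n : ℕ} {x₀ : ℝ} {k l : ℕ} {σ τ : ℝ} {A B : ℝ → Matrix (Fin n) (Fin n) ℂ}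

theorem matO (hA : MatDiffO x₀ k σ A) : MatO σ A := fun i j => (hA i j).isBigO

theorem mono (hA : MatDiffO x₀ k σ A) (hl : l ≤ k) (hσ : σ ≤ τ) : MatDiffO x₀ l τ A :=
  fun i j => (hA i j).mono hl hσ

theorem zero : MatDiffO x₀ k σ fun _ => (0 : Matrix (Fin n) (Fin n) ℂ) :=
  fun _ _ => DiffO.zero

theorem add (hA : MatDiffO x₀ k σ A) (hB : MatDiffO x₀ k σ B) :
    MatDiffO x₀ k σ fun x => A x + B x := fun i j => (hA i j).add (hB i j)

theorem neg (hA : MatDiffO x₀ k σ A) : MatDiffO x₀ k σ fun x => -A x := fun i j => (hA i j).neg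

theorem sub (hA : MatDiffO x₀ k σ A) (hB : MatDiffO x₀ k σ B) :
    MatDiffO x₀ k σ fun x => A x - B x := fun i j => (hA i j).sub (hB i j)

theorem mul (hA : MatDiffO x₀ k σ A) (hB : MatDiffO x₀ k τ B) :
    MatDiffO x₀ k (σ + τ) fun x => A x * B x := fun i j => by
  simp only [Matrix.mul_apply]
  exact DiffO.sum fun l _ => (hA i l).mul (hB l j)

theorem smul {f : ℝ → ℂ} (hf : DiffO x₀ k σ f) (hB : MatDiffO x₀ k τ B) :
    MatDiffO x₀ k (σ + τ) fun x => f x • B x := fun i j => hf.mul (hB i j)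

theorem sum {ι : Type*} {s : Finset ι} {A : ι → ℝ → Matrix (Fin n) (Fin n) ℂ}
    (h : ∀ i ∈ s, MatDiffO x₀ k σ (A i)) : MatDiffO x₀ k σ fun x => ∑ i ∈ s, A i x := fun i j => by
  simp only [Matrix.sum_apply]
  exact DiffO.sum fun l hl => h l hl i j

theorem ite {p : Prop} [Decidable p] (hA : p → MatDiffO x₀ k σ A) :
    MatDiffO x₀ k σ fun x => if p then A x else 0 := by
  by_cases h : p
  · simpa [h] using hA h
  · simpa [h] using zero

theorem deriv (hA : MatDiffO x₀ (k + 1) σ A) : MatDiffO x₀ k (σ - 1) (matDeriv A) :=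
  fun i j => (hA i j).deriv

end MatDiffO

/-! ### The calculus of `MatO` -/

namespace MatO

variable {n : ℕ} {σ τ : ℝ} {A B : ℝ → Matrix (Fin n) (Fin n) ℂ}

theorem mono (hA : MatO σ A) (h : σ ≤ τ) : MatO τ A :=
  fun i j => (hA i j).trans (isBigO_rpow_mono h)

theorem congr' (hA : MatO σ A) (h : ∀ᶠ x in atTop, A x = B x) : MatO σ B := fun i j =>
  (hA i j).congr' (h.mono fun x hx => by simp [hx]) EventuallyEq.rfl

theorem zero : MatO σ fun _ => (0 : Matrix (Fin n) (Fin n) ℂ) := fun _ _ => by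
  simpa using isBigO_zero _ _

theorem add (hA : MatO σ A) (hB : MatO σ B) : MatO σ fun x => A x + B x :=
  fun i j => (hA i j).add (hB i j)

theorem sum {ι : Type*} {s : Finset ι} {A : ι → ℝ → Matrix (Fin n) (Fin n) ℂ}
    (h : ∀ i ∈ s, MatO σ (A i)) : MatO σ fun x => ∑ i ∈ s, A i x := fun i j => by
  simp only [Matrix.sum_apply]
  exact IsBigO.fun_sum fun l hl => h l hl i j

theorem mul (hA : MatO σ A) (hB : MatO τ B) : MatO (σ + τ) fun x => A x * B x := fun i j => by
  simp only [Matrix.mul_apply]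
  exact IsBigO.fun_sum fun l _ => isBigO_rpow_mul (hA i l) (hB l j) le_rfl

theorem tendsto_zero (hA : MatO σ A) (hσ : σ < 0) : Tendsto A atTop (𝓝 0) := by
  refine tendsto_pi_nhds.2 fun i => tendsto_pi_nhds.2 fun j => (hA i j).trans_tendsto ?_
  simpa using tendsto_rpow_neg_atTop (y := -σ) (by linarith)

theorem isUnit_det_one_add (hA : MatO σ A) (hσ : σ < 0) :
    ∀ᶠ x in atTop, IsUnit (1 + A x).det := by
  have h1 : Tendsto (fun x => (1 + A x).det) atTop (𝓝 1) := by
    have : Continuous fun B : Matrix (Fin n) (Fin n) ℂ => (1 + B).det := by fun_prop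
    simpa [Function.comp_def] using (this.tendsto 0).comp (hA.tendsto_zero hσ)
  filter_upwards [h1.eventually_ne one_ne_zero] with x hx
  exact isUnit_iff_ne_zero.2 hx

/-- By Cramer's rule the inverse is continuous near the identity, so it converges to `I`;
boundedness is all that the remainder estimate needs. -/
theorem inv_one_add (hA : MatO σ A) (hσ : σ < 0) : MatO 0 fun x => (1 + A x)⁻¹ := by
  have hc : Continuous fun B : Matrix (Fin n) (Fin n) ℂ => 1 + B := by fun_prop
  have h1 : Tendsto (fun x => (1 + A x).det) atTop (𝓝 1) := by
    simpa [Function.comp_def] using (hc.matrix_det.tendsto 0).comp (hA.tendsto_zero hσ)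
  have h2 : Tendsto (fun x => (1 + A x).adjugate) atTop (𝓝 1) := by
    simpa [Function.comp_def] using (hc.matrix_adjugate.tendsto 0).comp (hA.tendsto_zero hσ)
  have h3 : Tendsto (fun x => (1 + A x)⁻¹) atTop (𝓝 1) := by
    simp only [Matrix.inv_def, Ring.inverse_eq_inv']
    simpa using (h1.inv₀ one_ne_zero).smul h2
  intro i j
  have h4 := tendsto_pi_nhds.1 (tendsto_pi_nhds.1 h3 i) j
  simpa using h4.isBigO_one ℝ

end MatO

/-! ### Orders of magnitude with their supply of derivatives -/

namespace System

variable {n : ℕ} {s : System n}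

/-- `A` has order `x^{-k a}`, with the differentiability the process needs at this order. -/
def HasOrder (s : System n) (k : ℕ) (A : ℝ → Matrix (Fin n) (Fin n) ℂ) : Prop :=
  MatDiffO s.x₀ (s.M - k) (-(k * s.a)) A

/-- The order estimates for the data at step `m`. -/
structure StageOrder (s : System n) (m : ℕ) (t : Stage n) : Prop where
  V_diag : m + 1 ≤ s.M → ∀ x > s.x₀, ∀ i, t.V 1 x i i = 0
  V_order : ∀ j, 1 ≤ j → j ≤ s.M - m → s.HasOrder (m + j - 1) (t.V j)
  φ_order : ∀ i, DiffO s.x₀ (s.M - (m + 1)) (-s.a) fun x => t.φ x i - s.φlim i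

/-- Higher order demands fewer derivatives, so either factor has at least the `M - (k + l)` that the
product must have. -/
theorem HasOrder.mul {k l : ℕ} {A B : ℝ → Matrix (Fin n) (Fin n) ℂ} (hA : s.HasOrder k A)
    (hB : s.HasOrder l B) : s.HasOrder (k + l) fun x => A x * B x := by
  refine ((MatDiffO.mono hA (l := s.M - (k + l)) (by omega) le_rfl).mul
    (MatDiffO.mono hB (by omega) le_rfl)).mono le_rfl ?_
  push_cast
  linarith

theorem HasOrder.add {k : ℕ} {A B : ℝ → Matrix (Fin n) (Fin n) ℂ} (hA : s.HasOrder k A)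
    (hB : s.HasOrder k B) : s.HasOrder k fun x => A x + B x := MatDiffO.add hA hB

theorem HasOrder.pow_mul {k l : ℕ} {A B : ℝ → Matrix (Fin n) (Fin n) ℂ} (hA : s.HasOrder k A)
    (hB : s.HasOrder l B) (r : ℕ) : s.HasOrder (r * k + l) fun x => A x ^ r * B x := by
  induction r with
  | zero => simpa using hB
  | succ r ih =>
    have h := hA.mul ih
    rw [show (r + 1) * k + l = k + (r * k + l) by ring]
    simpa only [pow_succ', mul_assoc] using h

/-! ### Orders of magnitude of the terms in one step -/

theorem Pmat_eq_add (m : ℕ) (t : Stage n) (x : ℝ) :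
    s.Pmat m t x = s.Qmat m t x + s.Qtmat m t x := by
  ext i j
  simp only [Qmat, Qtmat, Matrix.add_apply, Matrix.of_apply]
  split_ifs <;> simp

section Orders

variable {m : ℕ} {t : Stage n}

theorem StageOrder.V_one (ht : s.StageOrder m t) (hm : m + 1 ≤ s.M) : s.HasOrder m (t.V 1) := by
  simpa using ht.V_order 1 le_rfl (by omega)

theorem Qmat_order (ht : s.StageOrder m t) (hm : m + 1 ≤ s.M) : s.HasOrder m (s.Qmat m t) := by
  intro i j
  have hV := ht.V_one hm i j
  by_cases h : s.N ≤ i.val ∧ s.N ≤ j.val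
  · have hi : ¬ i.val < s.N := by omega
    have hj : ¬ j.val < s.N := by omega
    by_cases hij : i = j
    · simpa [Qmat, Pmat, hij] using DiffO.zero
    -- Size estimates do not need nonzero denominators: a constant is divided by, and a vanishing
    -- one gives `0` by convention. The spectral conditions matter only in the commutator identity.
    by_cases hK : s.K = 0
    · simpa [Qmat, Pmat, h, hi, hj, hij, hK, div_eq_mul_inv, mul_comm] using
        hV.const_mul (s.d j - s.d i - (m * s.a : ℝ))⁻¹
    · simpa [Qmat, Pmat, h, hi, hj, hij, hK, div_eq_mul_inv, mul_comm] using
        hV.const_mul (s.d j - s.d i)⁻¹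
  · simpa [Qmat, h] using DiffO.zero

/-- `HasOrder (m + L)` would record only `M - (m + L)` derivatives, possibly none, whereas `Q̃_m`
must still be differentiated. All `M - m` are kept; `1/λ` has them since `m ≥ 1`. -/
theorem Qtmat_order (hs : s.Admissible) (hm1 : 1 ≤ m) (ht : s.StageOrder m t)
    (hm : m + 1 ≤ s.M) :
    MatDiffO s.x₀ (s.M - m) (-(((m : ℝ) + s.L) * s.a)) (s.Qtmat m t) := by
  intro i j
  have hV : DiffO s.x₀ (s.M - m) (-(((m : ℝ) + s.L) * s.a))
      fun x => (s.lam x)⁻¹ * t.V 1 x i j := by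
    refine ((hs.lam_order.mono (l := s.M - m) (by omega) le_rfl).mul (ht.V_one hm i j)).mono
      le_rfl ?_
    linarith
  by_cases hij : i = j
  · simpa [Qtmat, Pmat, hij] using DiffO.zero
  by_cases hi : i.val < s.N
  · have hi' : ¬ s.N ≤ i.val := by omega
    by_cases hj : j.val < s.N
    · refine (hV.const_mul (s.d j - s.d i)⁻¹).congr fun x _ => ?_
      simp [Qtmat, Pmat, hi, hi', hj, hij, div_eq_mul_inv]
      ring
    · refine (hV.const_mul (-(s.d i)⁻¹)).congr fun x _ => ?_
      simp [Qtmat, Pmat, hi, hi', hj, hij, div_eq_mul_inv]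
      ring
  · by_cases hj : j.val < s.N
    · have hj' : ¬ s.N ≤ j.val := by omega
      refine (hV.const_mul (s.d j)⁻¹).congr fun x _ => ?_
      simp [Qtmat, Pmat, hi, hj', hj, hij, div_eq_mul_inv]
      ring
    · have h : s.N ≤ i.val ∧ s.N ≤ j.val := by omega
      simpa [Qtmat, h] using DiffO.zero

theorem Qtmat_order' (hs : s.Admissible) (hm1 : 1 ≤ m) (ht : s.StageOrder m t)
    (hm : m + 1 ≤ s.M) : s.HasOrder (m + s.L) (s.Qtmat m t) := by
  refine (Qtmat_order hs hm1 ht hm).mono (by omega) ?_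
  push_cast
  rfl

theorem Pmat_order (hs : s.Admissible) (hm1 : 1 ≤ m) (ht : s.StageOrder m t)
    (hm : m + 1 ≤ s.M) : s.HasOrder m (s.Pmat m t) := by
  have h := (Qmat_order ht hm).add ((Qtmat_order hs hm1 ht hm).mono le_rfl
    (τ := -(m * s.a)) (by
      have := mul_nonneg (Nat.cast_nonneg (α := ℝ) s.L) hs.a_pos.le
      linarith))
  simpa only [← Pmat_eq_add] using h

/-- The factor `x⁻¹` from differentiation meets `x^{1-Ka}` from `1/ρ`, with net effect `x^{-Ka}`.
One derivative is spent, and the `M - 2` derivatives of `1/ρ` suffice because `m ≥ 1`. -/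
theorem inv_ρ_smul_deriv_order (hs : s.Admissible) (hm1 : 1 ≤ m) (hm : m + 1 ≤ s.M) {p : ℝ}
    {A : ℝ → Matrix (Fin n) (Fin n) ℂ} (hA : MatDiffO s.x₀ (s.M - m) (-(p * s.a)) A) :
    MatDiffO s.x₀ (s.M - (m + 1)) (-((p + s.K) * s.a))
      fun x => (s.ρ x)⁻¹ • matDeriv A x := by
  have h1 : MatDiffO s.x₀ (s.M - (m + 1)) (-(p * s.a) - 1) (matDeriv A) := by
    refine MatDiffO.deriv ?_
    rwa [show s.M - (m + 1) + 1 = s.M - m by omega]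
  refine (MatDiffO.smul (hs.ρ_order.mono (l := s.M - (m + 1)) (by omega) le_rfl) h1).mono le_rfl ?_
  linarith

theorem Umat_order (hs : s.Admissible) (hm1 : 1 ≤ m) (ht : s.StageOrder m t)
    (hm : m + 1 ≤ s.M) :
    MatDiffO s.x₀ (s.M - m) (-(((m : ℝ) + s.L) * s.a)) (s.Umat t) := by
  intro i j
  have hV : DiffO s.x₀ (s.M - m) (-(((m : ℝ) + s.L) * s.a))
      fun x => (s.lam x)⁻¹ * t.V 1 x i j := by
    refine ((hs.lam_order.mono (l := s.M - m) (by omega) le_rfl).mul (ht.V_one hm i j)).mono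
      le_rfl ?_
    linarith
  by_cases h1 : i.val < s.N ∧ s.N ≤ j.val
  · refine (hV.const_mul (s.d j / s.d i)).congr fun x _ => ?_
    simp only [Umat, Matrix.of_apply, h1, and_self, if_true]
    ring
  by_cases h2 : s.N ≤ i.val ∧ j.val < s.N
  · refine (hV.const_mul (s.d i / s.d j)).congr fun x _ => ?_
    simp only [Umat, Matrix.of_apply, h1, h2, and_self, if_true, if_false]
    ring
  simpa [Umat, h1, h2] using DiffO.zero

theorem φ_order_zero (hs : s.Admissible) (ht : s.StageOrder m t) (i : Fin n) :
    DiffO s.x₀ (s.M - (m + 1)) 0 fun x => t.φ x i := by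
  have h := ((ht.φ_order i).mono le_rfl (by linarith [hs.a_pos] : -s.a ≤ 0)).add
    (DiffO.const (s.φlim i))
  simpa using h

theorem Δfst_order (hs : s.Admissible) (ht : s.StageOrder m t) :
    MatDiffO s.x₀ (s.M - (m + 1)) 0 (s.Δfst t) := by
  intro i j
  by_cases hij : i = j
  · subst hij
    by_cases hi : i.val < s.N
    · simpa [Δfst, hi] using φ_order_zero hs ht i
    · simpa [Δfst, hi] using DiffO.zero
  · simpa [Δfst, hij] using DiffO.zero

theorem Δsnd_order (ht : s.StageOrder m t) :
    MatDiffO s.x₀ (s.M - (m + 1)) (-s.a) (s.Δsnd t) := by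
  intro i j
  by_cases hij : i = j
  · subst hij
    by_cases hi : i.val < s.N
    · simpa [Δsnd, hi] using DiffO.zero
    · simpa [Δsnd, hi, φlim] using ht.φ_order i
  · simpa [Δsnd, hij] using DiffO.zero

theorem commutator_order {k : ℕ} {σ τ υ : ℝ} {A B : ℝ → Matrix (Fin n) (Fin n) ℂ}
    (hA : MatDiffO s.x₀ k σ A) (hB : MatDiffO s.x₀ k τ B) (h : σ + τ ≤ υ) :
    MatDiffO s.x₀ k υ fun x => A x * B x - B x * A x :=
  ((hA.mul hB).mono le_rfl h).sub ((hB.mul hA).mono le_rfl (by linarith))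

/-- The first diagonal block is merely bounded, with limit `D̃₁`, so the whole gain comes from
`Q̃_m`; the second block, which tends to `0`, gives the next two commutators an extra `x^{-a}`. -/
theorem Tbar_order (hs : s.Admissible) (hm1 : 1 ≤ m) (ht : s.StageOrder m t)
    (hm : m + 1 ≤ s.M) :
    MatDiffO s.x₀ (s.M - (m + 1)) (-(((m : ℝ) + s.L) * s.a)) (s.Tbar m t) :=
  commutator_order (Δfst_order hs ht)
    ((Qtmat_order hs hm1 ht hm).mono (l := s.M - (m + 1)) (by omega) le_rfl) (by linarith)

theorem Ttil_order (hs : s.Admissible) (hm1 : 1 ≤ m) (ht : s.StageOrder m t)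
    (hm : m + 1 ≤ s.M) :
    MatDiffO s.x₀ (s.M - (m + 1)) (-(((m : ℝ) + s.L + 1) * s.a)) (s.Ttil m t) :=
  commutator_order (Δsnd_order ht)
    ((Qtmat_order hs hm1 ht hm).mono (l := s.M - (m + 1)) (by omega) le_rfl) (by linarith)

theorem Tmat_order (ht : s.StageOrder m t) (hm : m + 1 ≤ s.M) :
    MatDiffO s.x₀ (s.M - (m + 1)) (-(((m : ℝ) + 1) * s.a)) (s.Tmat m t) :=
  commutator_order (Δsnd_order ht)
    (MatDiffO.mono (Qmat_order ht hm) (l := s.M - (m + 1)) (by omega) le_rfl) (by linarith)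

/-- Terms built from derivatives or from `Φ_m` have only `M - (m + 1)` derivatives left. This covers
the required `M - k` because their order `k` is at least `m + 1`, by `L ≥ 1` and by `K ≠ 0` for the
term with `Q_m'`. -/
theorem baseTerm_order (hs : s.Admissible) (hm1 : 1 ≤ m) (ht : s.StageOrder m t)
    (hm : m + 1 ≤ s.M) (k : ℕ) : s.HasOrder k (s.baseTerm m t k) := by
  have hL := hs.one_le_L
  have hV : ∀ j ∈ Finset.Icc 1 (s.M - m), s.HasOrder (m + j - 1) (t.V j) := fun j hj => by
    rw [Finset.mem_Icc] at hj
    exact ht.V_order j hj.1 hj.2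
  refine HasOrder.add (HasOrder.add (HasOrder.add (HasOrder.add (HasOrder.add (HasOrder.add
    ?_ ?_) ?_) ?_) ?_) ?_) ?_
  · refine MatDiffO.ite fun h => ?_
    obtain ⟨hK, rfl⟩ := h
    refine (inv_ρ_smul_deriv_order hs hm1 hm (Qmat_order ht hm)).neg.mono (by omega) ?_
    push_cast
    rfl
  · refine MatDiffO.ite fun h => ?_
    subst h
    refine (inv_ρ_smul_deriv_order hs hm1 hm (Qtmat_order hs hm1 ht hm)).neg.mono (by omega) ?_
    push_cast
    linarith
  · refine MatDiffO.ite fun h => ?_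
    subst h
    refine MatDiffO.mono (((Umat_order hs hm1 ht hm).mono (by omega) le_rfl).add
      (Tbar_order hs hm1 ht hm)) (by omega) ?_
    push_cast
    rfl
  · refine MatDiffO.ite fun h => ?_
    subst h
    refine (Ttil_order hs hm1 ht hm).mono (by omega) ?_
    push_cast
    rfl
  · refine MatDiffO.ite fun h => ?_
    subst h
    refine (Tmat_order ht hm).mono (by omega) ?_
    push_cast
    rfl
  · refine MatDiffO.sum fun j hj => MatDiffO.ite fun h => ?_
    rw [Finset.mem_Icc] at hj
    have := hV j (Finset.mem_Icc.2 ⟨by omega, hj.2⟩)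
    rwa [show m + j - 1 = k by omega] at this
  · refine MatDiffO.sum fun j hj => MatDiffO.add (MatDiffO.ite fun h => ?_)
      (MatDiffO.ite fun h => ?_)
    · have := (hV j hj).mul (Qmat_order ht hm)
      rw [Finset.mem_Icc] at hj
      rwa [show m + j - 1 + m = k by omega] at this
    · have := (hV j hj).mul (Qtmat_order' hs hm1 ht hm)
      rw [Finset.mem_Icc] at hj
      rwa [show m + j - 1 + (m + s.L) = k by omega] at this

theorem collated_order (hs : s.Admissible) (hm1 : 1 ≤ m) (ht : s.StageOrder m t)
    (hm : m + 1 ≤ s.M) (k : ℕ) : s.HasOrder k (s.collated m t k) := by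
  refine MatDiffO.ite fun _ => MatDiffO.sum fun r _ => MatDiffO.ite fun h => ?_
  have := HasOrder.pow_mul (A := fun x => -s.Pmat m t x) (MatDiffO.neg (Pmat_order hs hm1 ht hm))
    (baseTerm_order hs hm1 ht hm (k - r * m)) r
  rwa [show r * m + (k - r * m) = k by omega] at this

theorem StageOrder.next (hs : s.Admissible) (hm1 : 1 ≤ m) (ht : s.StageOrder m t)
    (hm : m + 1 ≤ s.M) : s.StageOrder (m + 1) (s.next m t) := by
  have hC := collated_order hs hm1 ht hm
  refine ⟨fun _ x _ i => ?_, fun j hj1 hj => ?_, fun i => ?_⟩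
  · simp [System.next, nextV]
  · by_cases h : j = 1
    · subst h
      intro p q
      by_cases hpq : p = q
      · subst hpq
        simpa [System.next, nextV] using DiffO.zero
      · simpa [System.next, nextV, hpq] using hC (m + 1) p q
    · have hV : (s.next m t).V j = s.collated m t (m + j) := by
        funext x
        simp [System.next, nextV, h]
      rw [hV, show m + 1 + j - 1 = m + j by omega]
      exact hC (m + j)
  -- The diagonal changes by a term of order `m + 1 ≥ 1`, so its limit is the same at every stage.
  · have h1 := ((ht.φ_order i).mono (l := s.M - (m + 1 + 1)) (by omega) le_rfl).add
      ((hC (m + 1) i i).mono (l := s.M - (m + 1 + 1)) (τ := -s.a) (by omega) (by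
        push_cast
        have := mul_nonneg (Nat.cast_nonneg (α := ℝ) m) hs.a_pos.le
        linarith))
    refine h1.congr fun x _ => ?_
    simp only [System.next, nextφ]
    ring

end Orders

theorem stage_succ (s : System n) {m : ℕ} (hm : 1 ≤ m) :
    s.stage (m + 1) = s.next m (s.stage m) := by
  simp [stage, show m ≠ 0 by omega]

theorem stageOrder_stage (hs : s.Admissible) {m : ℕ} (hm1 : 1 ≤ m) (hm : m ≤ s.M) :
    s.StageOrder m (s.stage m) := by
  induction m, hm1 using Nat.le_induction with
  | base =>
    refine ⟨fun h => hs.V_diag h, fun j hj1 hj p q => ?_, fun i => ?_⟩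
    · simpa [stage] using hs.V_order j hj1 (by omega) p q
    · simpa [stage] using hs.φ_order i
  | succ m hm1 ih =>
    rw [stage_succ s hm1]
    exact (ih (by omega)).next hs hm1 hm

end System

namespace System

variable {n : ℕ} {s : System n} {m : ℕ} {t : Stage n}

/-! ### Removal of the dominant term -/

/-- The interval cannot contain `0`: there `ρ` would equal `0⁻¹ = 0` by convention, while `ρ` has no
zeros. -/
theorem InverseFactor.pos (hs : s.Admissible) (h : s.InverseFactor) {x : ℝ} (hx : s.x₀ < x) :
    0 < x := by
  by_contra! h0
  have h1 := h.ρ_eq 0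
  have h2 := hs.ρ_ne_zero 0
  simp only [gt_iff_lt, inv_zero, Complex.ofReal_zero] at h1 h2
  rcases h0.lt_or_eq with h3 | h3
  · exact h2 (hx.trans h3) (h1 (hx.trans h3))
  · subst h3
    exact h2 hx (h1 hx)

theorem matDeriv_Pmat (hs : s.Admissible) (hm1 : 1 ≤ m) (ht : s.StageOrder m t)
    (hm : m + 1 ≤ s.M) {x : ℝ} (hx : s.x₀ < x) :
    matDeriv (s.Pmat m t) x = matDeriv (s.Qmat m t) x + matDeriv (s.Qtmat m t) x := by
  ext i j
  simp only [matDeriv, Matrix.of_apply, Matrix.add_apply, Pmat_eq_add]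
  exact deriv_fun_add ((Qmat_order ht hm i j).differentiableAt (by omega) hx)
    ((Qtmat_order hs hm1 ht hm i j).differentiableAt (by omega) hx)

/-- The derivative of the lower right block when `K = 0`. -/
theorem inv_ρ_smul_deriv_Qmat (hs : s.Admissible) (hK : s.K = 0) (hI : s.InverseFactor)
    (hm1 : 1 ≤ m) (hm : m + 1 ≤ s.M) {x : ℝ} (hx : s.x₀ < x) :
    (s.ρ x)⁻¹ • matDeriv (s.Qmat m (s.stage m)) x
      = (-(m * s.a : ℝ) : ℂ) • s.Qmat m (s.stage m) x := by
  ext i j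
  simp only [Matrix.smul_apply, smul_eq_mul, matDeriv, Matrix.of_apply]
  by_cases h : s.N ≤ i.val ∧ s.N ≤ j.val
  swap
  · simp [Qmat, h]
  by_cases hij : i = j
  · simp [Qmat, Pmat, hij]
  have hi : ¬ i.val < s.N := by omega
  have hj : ¬ j.val < s.N := by omega
  obtain ⟨c, hc⟩ := hI.V_block m hm1 (by omega) i j h.1 h.2
  set e : ℂ := s.d j - s.d i - (m * s.a : ℝ) with he
  have hx0 := hI.pos hs hx
  have hQ : ∀ y > s.x₀, s.Qmat m (s.stage m) y i j
      = c * ((y ^ (-(m * s.a)) : ℝ) : ℂ) / e := fun y hy => by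
    simp only [Qmat, Pmat, Matrix.of_apply, h, and_self, if_true, hi, hj, hij, hK, if_false,
      hc y hy, ← he]
  have hd : HasDerivAt (fun y => s.Qmat m (s.stage m) y i j)
      (c * ((-(m * s.a) * x ^ (-(m * s.a) - 1) : ℝ) : ℂ) / e) x := by
    have h1 := (Real.hasDerivAt_rpow_const (p := -(m * s.a)) (Or.inl hx0.ne')).ofReal_comp
    refine ((h1.const_mul c).div_const e).congr_of_eventuallyEq ?_
    filter_upwards [Ioi_mem_nhds hx] with y hy using hQ y hy
  rw [hd.deriv, hQ x hx, hI.ρ_eq x hx, Real.rpow_sub_one hx0.ne']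
  have hxc : (x : ℂ) ≠ 0 := by exact_mod_cast hx0.ne'
  push_cast
  field_simp

/-- The terms that remain after the dominant term `V_{1m}` has been removed. -/
theorem commutator_add_V_one (hs : s.Admissible) (ht : s.StageOrder m t) (hm : m + 1 ≤ s.M)
    {x : ℝ} (hx : s.x₀ < x)
    (hI : s.K = 0 → ∀ i j : Fin n, s.N ≤ i.val → s.N ≤ j.val →
      ((m * s.a : ℝ) : ℂ) ≠ s.d j - s.d i) :
    t.V 1 x + s.Λmat t x * s.Pmat m t x - s.Pmat m t x * s.Λmat t x
      = s.Umat t x + s.Tbar m t x + s.Ttil m t x + s.Tmat m t x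
        - (if s.K = 0 then ((m * s.a : ℝ) : ℂ) else 0) • s.Qmat m t x := by
  ext i j
  simp only [Λmat, Tbar, Ttil, Tmat, Δfst, Δsnd, Matrix.add_apply, Matrix.sub_apply,
    Matrix.diagonal_mul, Matrix.mul_diagonal, Matrix.smul_apply, smul_eq_mul]
  by_cases hij : i = j
  · subst hij
    have h1 : s.Pmat m t x i i = 0 := by simp [Pmat]
    have h2 : s.Umat t x i i = 0 := by
      simp only [Umat, Matrix.of_apply]
      rw [if_neg (by omega), if_neg (by omega)]
    simp [h1, h2, Qmat, Qtmat, ht.V_diag hm x hx i]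
  have hlam := hs.lam_ne_zero x hx
  by_cases hi : i.val < s.N
  · have hi' : ¬ s.N ≤ i.val := by omega
    by_cases hj : j.val < s.N
    · have hj' : ¬ s.N ≤ j.val := by omega
      have hd : s.d j - s.d i ≠ 0 := sub_ne_zero.2 fun h =>
        hij (hs.d_inj_fst j i hj hi h).symm
      simp only [Qmat, Qtmat, Pmat, Umat, Λ₀, Matrix.of_apply, hi, hi', hj, hj', hij, if_true,
        if_false, and_true, and_false]
      field_simp
      ring
    -- The exact denominator would be `d_j - λ d_i`. Dropping `d_j` leaves the residue `λ⁻¹ (d_j /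
    -- d_i) v_ij`, which is the entry of `U_m`; the mirrored block behaves alike.
    · have hj' : s.N ≤ j.val := by omega
      have hd := hs.d_ne_zero (by omega) i hi
      simp only [Qmat, Qtmat, Pmat, Umat, Λ₀, Matrix.of_apply, hi, hi', hj, hj', hij, if_true,
        if_false, and_true, and_false]
      field_simp
      ring
  · have hi' : s.N ≤ i.val := by omega
    by_cases hj : j.val < s.N
    · have hj' : ¬ s.N ≤ j.val := by omega
      have hd := hs.d_ne_zero (by omega) j hj
      simp only [Qmat, Qtmat, Pmat, Umat, Λ₀, Matrix.of_apply, hi, hi', hj, hj', hij, if_true,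
        if_false, and_true, and_false]
      field_simp
      ring
    · have hj' : s.N ≤ j.val := by omega
      by_cases hK : s.K = 0
      -- With the shifted denominator `v_ij + (d_i - d_j) p_ij = -m a p_ij`, the source of the extra
      -- multiple of `Q_m`.
      · have hd : s.d j - s.d i - (m * s.a : ℝ) ≠ 0 := sub_ne_zero.2 (hI hK i j hi' hj').symm
        simp only [Qmat, Qtmat, Pmat, Umat, Λ₀, Matrix.of_apply, hi, hi', hj, hj', hij, hK, if_true,
          if_false, and_true, and_false]
        field_simp
        ring
      · have hd : s.d j - s.d i ≠ 0 := sub_ne_zero.2 fun h =>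
          hij (hs.d_inj_snd j i hj' hi' h).symm
        simp only [Qmat, Qtmat, Pmat, Umat, Λ₀, Matrix.of_apply, hi, hi', hj, hj', hij, hK, if_true,
          if_false, and_true, and_false]
        field_simp
        ring

/-- For `K = 0` the power law gives `-ρ⁻¹ Q_m' = m a Q_m`, which cancels the residue `-m a Q_m` of
the shifted denominator. For `K ≥ 1` there is no shift and `-ρ⁻¹ Q_m'` survives as a term of higher
order. -/
theorem dominant_removed (hs : s.Admissible) (hK : s.K = 0 → s.InverseFactor) (hm1 : 1 ≤ m)
    (hm : m + 1 ≤ s.M) {x : ℝ} (hx : s.x₀ < x) :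
    -((s.ρ x)⁻¹ • matDeriv (s.Pmat m (s.stage m)) x) + (s.stage m).V 1 x
        + s.Λmat (s.stage m) x * s.Pmat m (s.stage m) x
        - s.Pmat m (s.stage m) x * s.Λmat (s.stage m) x
      = (if s.K = 0 then 0 else -((s.ρ x)⁻¹ • matDeriv (s.Qmat m (s.stage m)) x))
        - (s.ρ x)⁻¹ • matDeriv (s.Qtmat m (s.stage m)) x
        + s.Umat (s.stage m) x + s.Tbar m (s.stage m) x + s.Ttil m (s.stage m) x
        + s.Tmat m (s.stage m) x := by
  have ht := stageOrder_stage hs hm1 (by omega : m ≤ s.M)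
  have h := commutator_add_V_one hs ht hm hx fun h0 i j hi hj =>
    (hK h0).nonresonant m hm1 (by omega) i j hi hj
  rw [matDeriv_Pmat hs hm1 ht hm hx, smul_add, add_assoc _ ((s.stage m).V 1 x), add_sub_assoc, h]
  by_cases h0 : s.K = 0
  · rw [inv_ρ_smul_deriv_Qmat hs h0 (hK h0) hm1 hm hx, if_pos h0, if_pos h0, neg_smul]
    abel
  · rw [if_neg h0, if_neg h0, zero_smul]
    abel

/-! ### The remainder -/

theorem sum_range_ite_eq {α : Type*} [AddCommMonoid α] {b c : ℕ} (h : c < b) (A : α) :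
    ∑ k ∈ Finset.range b, (if k = c then A else 0) = A := by
  simp [h]

theorem sum_range_ite_succ_eq {α : Type*} [AddCommMonoid α] {b c : ℕ} (h0 : 1 ≤ c) (h : c ≤ b)
    (A : α) : ∑ k ∈ Finset.range b, (if k + 1 = c then A else 0) = A := by
  conv_rhs => rw [← sum_range_ite_eq (show c - 1 < b by omega) A]
  exact Finset.sum_congr rfl fun k _ => if_congr (by omega) rfl rfl

/-- The length of the range exceeds every order that can be assigned, so each term of the list is
met exactly once. -/
theorem sum_baseTerm (s : System n) (hm1 : 1 ≤ m) (hm : m + 1 ≤ s.M) (t : Stage n) (x : ℝ) :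
    ∑ k ∈ Finset.range (2 * m + s.M + s.K + s.L + 2), s.baseTerm m t k x
      = (if s.K = 0 then 0 else -((s.ρ x)⁻¹ • matDeriv (s.Qmat m t) x))
        - (s.ρ x)⁻¹ • matDeriv (s.Qtmat m t) x
        + s.Umat t x + s.Tbar m t x + s.Ttil m t x + s.Tmat m t x
        + (∑ j ∈ Finset.Icc 1 (s.M - m), t.V j x - t.V 1 x)
        + (∑ j ∈ Finset.Icc 1 (s.M - m), t.V j x) * s.Pmat m t x := by
  have hV : ∑ j ∈ Finset.Icc 1 (s.M - m), t.V j x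
      = t.V 1 x + ∑ j ∈ Finset.Icc 2 (s.M - m), t.V j x := by
    rw [← Finset.add_sum_Ioc_eq_sum_Icc (by omega : 1 ≤ s.M - m)]
    rfl
  simp only [baseTerm, Finset.sum_add_distrib]
  rw [sum_range_ite_eq (by omega), sum_range_ite_eq (by omega), sum_range_ite_eq (by omega),
    sum_range_ite_eq (by omega), Finset.sum_comm, Finset.sum_comm (t := Finset.Icc 1 (s.M - m)),
    Finset.sum_comm (t := Finset.Icc 1 (s.M - m)), Pmat_eq_add, mul_add, Finset.sum_mul,
    Finset.sum_mul]
  have h2 : ∀ j ∈ Finset.Icc 2 (s.M - m), ∑ k ∈ Finset.range (2 * m + s.M + s.K + s.L + 2),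
      (if k + 1 = m + j then t.V j x else 0) = t.V j x := fun j hj => by
    rw [Finset.mem_Icc] at hj
    exact sum_range_ite_succ_eq (by omega) (by omega) _
  have h3 : ∀ j ∈ Finset.Icc 1 (s.M - m), ∑ k ∈ Finset.range (2 * m + s.M + s.K + s.L + 2),
      (if k + 1 = 2 * m + j then t.V j x * s.Qmat m t x else 0) = t.V j x * s.Qmat m t x :=
    fun j hj => by
      rw [Finset.mem_Icc] at hj
      exact sum_range_ite_succ_eq (by omega) (by omega) _
  have h4 : ∀ j ∈ Finset.Icc 1 (s.M - m), ∑ k ∈ Finset.range (2 * m + s.M + s.K + s.L + 2),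
      (if k + 1 = 2 * m + j + s.L then t.V j x * s.Qtmat m t x else 0)
        = t.V j x * s.Qtmat m t x := fun j hj => by
      rw [Finset.mem_Icc] at hj
      exact sum_range_ite_succ_eq (by omega) (by omega) _
  rw [Finset.sum_congr rfl h2, Finset.sum_congr rfl h3, Finset.sum_congr rfl h4, hV]
  by_cases h0 : s.K = 0
  · simp only [h0, ne_eq, not_true, false_and, if_false, if_true, Finset.sum_const_zero]
    abel
  · simp only [h0, ne_eq, not_false_iff, true_and, if_false]
    rw [sum_range_ite_eq (by omega)]
    abel

/-- The matrix multiplied by `(I + P_m)⁻¹` in the transformed system. -/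
theorem transformed_eq (hs : s.Admissible) (hK : s.K = 0 → s.InverseFactor) (hm1 : 1 ≤ m)
    (hm : m + 1 ≤ s.M) {x : ℝ} (hx : s.x₀ < x) :
    s.transformed m (s.stage m) x = s.Λmat (s.stage m) x + (1 + s.Pmat m (s.stage m) x)⁻¹ *
      (∑ k ∈ Finset.range (2 * m + s.M + s.K + s.L + 2), s.baseTerm m (s.stage m) k x
        + ((s.stage m).E x + (s.stage m).E x * s.Pmat m (s.stage m) x)) := by
  rw [transformed, dominant_removed hs hK hm1 hm hx, sum_baseTerm s hm1 hm, Rmat, add_mul]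
  congr 2
  abel

/-- Every assigned order is at least `m + 1`; hence collation may begin there without losing
anything. -/
theorem baseTerm_eq_zero (hs : s.Admissible) (hm1 : 1 ≤ m) (t : Stage n) {k : ℕ} (hk : k ≤ m)
    (x : ℝ) : s.baseTerm m t k x = 0 := by
  have hL := hs.one_le_L
  have h2 : ∀ j ∈ Finset.Icc 2 (s.M - m), (if k + 1 = m + j then t.V j x else 0) = 0 :=
    fun j hj => by
      rw [Finset.mem_Icc] at hj
      exact if_neg (by omega)
  have h3 : ∀ j ∈ Finset.Icc 1 (s.M - m),
      ((if k + 1 = 2 * m + j then t.V j x * s.Qmat m t x else 0)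
        + (if k + 1 = 2 * m + j + s.L then t.V j x * s.Qtmat m t x else 0)) = 0 := fun j hj => by
    rw [Finset.mem_Icc] at hj
    rw [if_neg (by omega), if_neg (by omega), add_zero]
  rw [baseTerm, Finset.sum_eq_zero h2, Finset.sum_eq_zero h3, if_neg (by omega),
    if_neg (by omega), if_neg (by omega), if_neg (by omega), if_neg (by omega)]
  simp

theorem collated_eq_zero (hs : s.Admissible) (hm1 : 1 ≤ m) (t : Stage n) {k : ℕ} (hk : k ≤ m)
    (x : ℝ) : s.collated m t k x = 0 := by
  unfold collated
  split_ifs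
  · refine Finset.sum_eq_zero fun r _ => ?_
    rw [baseTerm_eq_zero hs hm1 t (by omega), mul_zero, ite_self]
  · rfl

/-- All collated terms together are contained in `Λ_{m+1}` and the `V_{j,m+1}`. -/
theorem sum_collated (hs : s.Admissible) (hm1 : 1 ≤ m) (hm : m + 1 ≤ s.M) (t : Stage n) (x : ℝ) :
    Matrix.diagonal (fun i => s.Λ₀ x i + s.nextφ m t x i)
      + ∑ j ∈ Finset.Icc 1 (s.M - (m + 1)), s.nextV m t j x
      = s.Λmat t x + ∑ k ∈ Finset.range s.M, s.collated m t k x := by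
  have hd : Matrix.diagonal (fun i => s.Λ₀ x i + s.nextφ m t x i)
      = s.Λmat t x + Matrix.diagonal fun i => s.collated m t (m + 1) x i i := by
    rw [Λmat, Matrix.diagonal_add]
    simp [nextφ, add_assoc]
  have hr : ∑ k ∈ Finset.range s.M, s.collated m t k x
      = ∑ j ∈ Finset.range (s.M - (m + 1)), s.collated m t (m + 1 + j) x := by
    conv_lhs => rw [show s.M = (m + 1) + (s.M - (m + 1)) by omega]
    rw [Finset.sum_range_add, Finset.sum_eq_zero, zero_add]
    intro k hk
    exact collated_eq_zero hs hm1 t (by simpa [Nat.lt_succ_iff] using hk) x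
  rw [hd, hr, add_assoc]
  congr 1
  have h1 : s.nextV m t 1 x
      = s.collated m t (m + 1) x - Matrix.diagonal fun i => s.collated m t (m + 1) x i i := by
    simp [nextV]
  rcases hp : s.M - (m + 1) with _ | p
  -- Here `m + 1 = M` is already beyond the cutoff: nothing is collated and the diagonal is left
  -- unchanged.
  · have h0 : s.collated m t (m + 1) x = 0 := by simp [collated, show ¬ m + 1 < s.M by omega]
    simp [h0]
  · rw [Finset.sum_range_succ', ← Finset.add_sum_Ioc_eq_sum_Icc (by omega : 1 ≤ p + 1), h1,
      add_comm (∑ j ∈ Finset.range p, _), ← add_assoc, add_sub_cancel, add_zero]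
    congr 1
    rw [← Finset.Ico_add_one_add_one_eq_Ioc, Finset.sum_Ico_eq_sum_range]
    refine Finset.sum_congr (by congr 1) fun j _ => ?_
    rw [nextV, if_neg (by omega)]
    congr 1
    omega

theorem sum_range_shift {α : Type*} [AddCommMonoid α] (g : ℕ → α) {b c M : ℕ} (h : M ≤ b) :
    ∑ k ∈ Finset.range M, (if c ≤ k then g (k - c) else 0)
      = ∑ k ∈ Finset.range b, (if c + k < M then g k else 0) := by
  rw [← Finset.sum_filter, ← Finset.sum_filter]
  refine Finset.sum_nbij' (fun k => k - c) (fun k => c + k) ?_ ?_ ?_ ?_ ?_ <;>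
    intro k hk <;> simp only [Finset.mem_filter, Finset.mem_range] at hk ⊢
  all_goals omega

/-- The part of the expansion that is not collated. -/
theorem sum_geom_sub_collated (hm1 : 1 ≤ m) (t : Stage n) {b : ℕ} (hb : s.M ≤ b) (x : ℝ) :
    (∑ r ∈ Finset.range s.M, (-s.Pmat m t x) ^ r) * ∑ k ∈ Finset.range b, s.baseTerm m t k x
      = ∑ k ∈ Finset.range s.M, s.collated m t k x
        + ∑ r ∈ Finset.range s.M, ∑ k ∈ Finset.range b,
          (if s.M ≤ r * m + k then (-s.Pmat m t x) ^ r * s.baseTerm m t k x else 0) := by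
  have h1 : ∑ k ∈ Finset.range s.M, s.collated m t k x
      = ∑ k ∈ Finset.range s.M, ∑ r ∈ Finset.range s.M,
        (if r * m ≤ k then (-s.Pmat m t x) ^ r * s.baseTerm m t (k - r * m) x else 0) := by
    refine Finset.sum_congr rfl fun k hk => ?_
    have hk := Finset.mem_range.1 hk
    rw [collated, if_pos hk]
    -- Since `m ≥ 1`, no `r > k` satisfies `r m ≤ k`, so all inner sums can run over the same range
    -- `r < M`.
    refine Finset.sum_subset (Finset.range_subset_range.2 hk) fun r _ hr => if_neg ?_
    rw [Finset.mem_range] at hr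
    have := Nat.le_mul_of_pos_right r hm1
    omega
  rw [h1, Finset.sum_comm, ← Finset.sum_add_distrib, Finset.sum_mul]
  refine Finset.sum_congr rfl fun r _ => ?_
  rw [sum_range_shift (fun k => (-s.Pmat m t x) ^ r * s.baseTerm m t k x) hb,
    ← Finset.sum_add_distrib, Finset.mul_sum]
  refine Finset.sum_congr rfl fun k _ => ?_
  by_cases h : r * m + k < s.M
  · simp [h, not_le.2 h]
  · simp [h, not_lt.1 h]

/-- By `(I + P)⁻¹ = ∑_{r<M} (-P)^r + (I + P)⁻¹ (-P)^M`, three kinds of terms survive the subtraction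
of the collated ones: products of total order at least `M`, terms with the factor `(-P)^M`, and
those carrying the old `E_m`. The inverse is bounded, so each is `O(x^{-Ma})`. -/
theorem next_E_order (hs : s.Admissible) (hK : s.K = 0 → s.InverseFactor) (hm1 : 1 ≤ m)
    (hm : m + 1 ≤ s.M) (hE : MatO (-(s.M * s.a)) (s.stage m).E) :
    MatO (-(s.M * s.a)) (s.next m (s.stage m)).E := by
  have ht := stageOrder_stage hs hm1 (by omega : m ≤ s.M)
  set t := s.stage m with htdef
  set b := 2 * m + s.M + s.K + s.L + 2 with hb
  have ha := hs.a_pos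
  have hP := (Pmat_order hs hm1 ht hm).matO
  have hma : -((m : ℝ) * s.a) < 0 := by
    have : (0 : ℝ) < m := by exact_mod_cast hm1
    have := mul_pos this ha
    linarith
  have hterm : ∀ r k, s.M ≤ r * m + k →
      MatO (-(s.M * s.a)) fun x => (-s.Pmat m t x) ^ r * s.baseTerm m t k x := fun r k h => by
    refine MatO.mono (HasOrder.pow_mul (A := fun x => -s.Pmat m t x)
      (MatDiffO.neg (Pmat_order hs hm1 ht hm)) (baseTerm_order hs hm1 ht hm k) r).matO ?_
    have h' : (s.M : ℝ) ≤ ((r * m + k : ℕ) : ℝ) := by exact_mod_cast h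
    have := mul_le_mul_of_nonneg_right h' ha.le
    linarith
  have hinv := hP.inv_one_add hma
  have h1 : MatO (-(s.M * s.a)) fun x => ∑ r ∈ Finset.range s.M, ∑ k ∈ Finset.range b,
      (if s.M ≤ r * m + k then (-s.Pmat m t x) ^ r * s.baseTerm m t k x else 0) := by
    refine MatO.sum fun r _ => MatO.sum fun k _ => ?_
    by_cases h : s.M ≤ r * m + k
    · simpa only [h, if_true] using hterm r k h
    · simpa only [h, if_false] using MatO.zero
  have h2 : MatO (-(s.M * s.a)) fun x => (1 + s.Pmat m t x)⁻¹ *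
      (∑ k ∈ Finset.range b, (-s.Pmat m t x) ^ s.M * s.baseTerm m t k x) := by
    simpa using hinv.mul (MatO.sum fun k _ => hterm s.M k
      ((Nat.le_mul_of_pos_right s.M hm1).trans (Nat.le_add_right _ _)))
  have h3 : MatO (-(s.M * s.a)) fun x => (1 + s.Pmat m t x)⁻¹ *
      (t.E x + t.E x * s.Pmat m t x) := by
    simpa using hinv.mul (hE.add ((hE.mul hP).mono (by linarith)))
  refine ((h1.add h2).add h3).congr' ?_
  filter_upwards [hP.isUnit_det_one_add hma, eventually_gt_atTop s.x₀] with x hx hx0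
  have hgeom : (1 + s.Pmat m t x)⁻¹ = ∑ r ∈ Finset.range s.M, (-s.Pmat m t x) ^ r
      + (1 + s.Pmat m t x)⁻¹ * (-s.Pmat m t x) ^ s.M := by
    have h := mul_neg_geom_sum (-s.Pmat m t x) s.M
    rw [sub_neg_eq_add] at h
    have h' := congrArg (fun A => (1 + s.Pmat m t x)⁻¹ * A) h
    simp only [Matrix.nonsing_inv_mul_cancel_left _ _ hx, mul_sub, mul_one] at h'
    rw [h']
    abel
  have hE' : (s.next m t).E x = s.transformed m t x
      - (Matrix.diagonal (fun i => s.Λ₀ x i + s.nextφ m t x i)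
        + ∑ j ∈ Finset.Icc 1 (s.M - (m + 1)), s.nextV m t j x) := by
    rw [← sub_sub]
    rfl
  have hS : (1 + s.Pmat m t x)⁻¹ * ∑ k ∈ Finset.range b, s.baseTerm m t k x
      = ∑ k ∈ Finset.range s.M, s.collated m t k x
        + ∑ r ∈ Finset.range s.M, ∑ k ∈ Finset.range b,
          (if s.M ≤ r * m + k then (-s.Pmat m t x) ^ r * s.baseTerm m t k x else 0)
        + (1 + s.Pmat m t x)⁻¹ *
          (∑ k ∈ Finset.range b, (-s.Pmat m t x) ^ s.M * s.baseTerm m t k x) := by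
    rw [← sum_geom_sub_collated hm1 t (by omega), ← Finset.mul_sum, ← mul_assoc, ← add_mul,
      ← hgeom]
  rw [hE', sum_collated hs hm1 hm, htdef, transformed_eq hs hK hm1 hm hx0, ← htdef, ← hb,
    mul_add _ (∑ k ∈ Finset.range b, s.baseTerm m t k x), hS]
  abel

theorem stage_E_order (hs : s.Admissible) (hK : s.K = 0 → s.InverseFactor) (hm1 : 1 ≤ m)
    (hm : m ≤ s.M) : MatO (-(s.M * s.a)) (s.stage m).E := by
  induction m, hm1 using Nat.le_induction with
  | base => simpa [stage] using hs.E_order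
  | succ m hm1 ih =>
    rw [stage_succ s hm1]
    exact next_E_order hs hK hm1 hm (ih (by omega))

end System

/-! ### Matrix functions of a real variable -/

section MatrixFunctions

variable {n : ℕ}

theorem hasDerivWithinAt_mulVec {A : ℝ → Matrix (Fin n) (Fin n) ℂ} {A' : Matrix (Fin n) (Fin n) ℂ}
    {Z : ℝ → Fin n → ℂ} {Z' : Fin n → ℂ} {S : Set ℝ} {x : ℝ}
    (hA : ∀ i j, HasDerivWithinAt (fun y => A y i j) (A' i j) S x)
    (hZ : HasDerivWithinAt Z Z' S x) :
    HasDerivWithinAt (fun y => (A y).mulVec (Z y)) (A'.mulVec (Z x) + (A x).mulVec Z') S x := by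
  rw [hasDerivWithinAt_pi] at hZ ⊢
  intro i
  simp only [Matrix.mulVec, dotProduct, Pi.add_apply, ← Finset.sum_add_distrib]
  exact HasDerivWithinAt.fun_sum fun j _ => (hA i j).mul (hZ j)

theorem differentiableAt_det {A : ℝ → Matrix (Fin n) (Fin n) ℂ} {x : ℝ}
    (hA : ∀ i j, DifferentiableAt ℝ (fun y => A y i j) x) :
    DifferentiableAt ℝ (fun y => (A y).det) x := by
  simp only [Matrix.det_apply]
  refine DifferentiableAt.fun_sum fun σ _ => ?_
  exact (DifferentiableAt.fun_finsetProd fun i _ => hA _ _).const_smul _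

theorem differentiableAt_inv_apply {A : ℝ → Matrix (Fin n) (Fin n) ℂ} {x : ℝ}
    (hA : ∀ i j, DifferentiableAt ℝ (fun y => A y i j) x) (hx : IsUnit (A x).det) (i j : Fin n) :
    DifferentiableAt ℝ (fun y => (A y)⁻¹ i j) x := by
  simp only [Matrix.inv_def, Ring.inverse_eq_inv', Matrix.smul_apply, smul_eq_mul,
    Matrix.adjugate_apply]
  refine ((differentiableAt_det hA).inv hx.ne_zero).mul (differentiableAt_det fun p q => ?_)
  by_cases h : p = j
  · subst h
    simp
  · simpa [h] using hA p q

theorem continuousOn_matrix {A : ℝ → Matrix (Fin n) (Fin n) ℂ} {S : Set ℝ}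
    (hA : ∀ i j, ContinuousOn (fun y => A y i j) S) : ContinuousOn A S :=
  continuousOn_pi.2 fun i => continuousOn_pi.2 fun j => hA i j

theorem continuousOn_matrix_apply {A : ℝ → Matrix (Fin n) (Fin n) ℂ} {S : Set ℝ}
    (hA : ContinuousOn A S) (i j : Fin n) : ContinuousOn (fun y => A y i j) S :=
  continuousOn_pi.1 (continuousOn_pi.1 hA i) j

theorem MatDiffO.continuousOn {x₀ : ℝ} {k : ℕ} {σ : ℝ} {A : ℝ → Matrix (Fin n) (Fin n) ℂ}
    (hA : MatDiffO x₀ k σ A) : ContinuousOn A (Ioi x₀) :=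
  continuousOn_matrix fun i j => (hA i j).continuousOn

theorem continuousOn_matrix_inv {A : ℝ → Matrix (Fin n) (Fin n) ℂ} {S : Set ℝ}
    (hA : ContinuousOn A S) (hu : ∀ x ∈ S, IsUnit (A x).det) :
    ContinuousOn (fun x => (A x)⁻¹) S := by
  have h1 : Continuous fun B : Matrix (Fin n) (Fin n) ℂ => B.det := continuous_id.matrix_det
  have h2 : Continuous fun B : Matrix (Fin n) (Fin n) ℂ => B.adjugate :=
    continuous_id.matrix_adjugate
  simp only [Matrix.inv_def, Ring.inverse_eq_inv']
  exact ((h1.comp_continuousOn hA).inv₀ fun x hx => (hu x hx).ne_zero).smul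
    (h2.comp_continuousOn hA)

end MatrixFunctions

namespace System

variable {n : ℕ} {s : System n} {m : ℕ}

/-! ### The transformation of the system -/

/-- Exact, with no estimate involved, because `E_{m+1}` is by definition whatever is left over. -/
theorem Λ_add_R_succ (s : System n) (hm1 : 1 ≤ m) (x : ℝ) :
    s.Λ (m + 1) x + s.R (m + 1) x = s.transformed m (s.stage m) x := by
  rw [Λ, R, stage_succ s hm1, Λmat, Rmat]
  simp only [System.next]
  abel

theorem one_add_P_mul_coeff (hs : s.Admissible) (hm1 : 1 ≤ m) {x : ℝ}
    (hx : s.x₀ < x) (hu : IsUnit (1 + s.P m x).det) :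
    (1 + s.P m x) * s.coeff (m + 1) x = s.coeff m x * (1 + s.P m x) - matDeriv (s.P m) x := by
  have hρ := hs.ρ_ne_zero x hx
  have h1 : (1 + s.P m x) * s.transformed m (s.stage m) x
      = (s.Λ m x + s.R m x) * (1 + s.P m x) - (s.ρ x)⁻¹ • matDeriv (s.P m) x := by
    rw [transformed, mul_add (1 + s.P m x)]
    change (1 + s.P m x) * s.Λ m x + (1 + s.P m x) * ((1 + s.P m x)⁻¹ *
      (-((s.ρ x)⁻¹ • matDeriv (s.P m) x) + (s.stage m).V 1 x + s.Λ m x * s.P m x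
        - s.P m x * s.Λ m x + (s.R m x - (s.stage m).V 1 x) + s.R m x * s.P m x)) = _
    rw [Matrix.mul_nonsing_inv_cancel_left _ _ hu]
    noncomm_ring
  rw [coeff, Λ_add_R_succ s hm1, mul_smul_comm, h1, smul_sub, smul_smul, mul_inv_cancel₀ hρ,
    one_smul, coeff, smul_mul_assoc]

theorem hasDerivAt_one_add_P (hs : s.Admissible) (hm1 : 1 ≤ m) (hm : m + 1 ≤ s.M) {x : ℝ}
    (hx : s.x₀ < x) (i j : Fin n) :
    HasDerivAt (fun y => (1 + s.P m y) i j) (matDeriv (s.P m) x i j) x := by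
  have ht := stageOrder_stage hs hm1 (by omega : m ≤ s.M)
  have h := ((Pmat_order hs hm1 ht hm i j).differentiableAt (by omega) hx).hasDerivAt
  exact h.const_add ((1 : Matrix (Fin n) (Fin n) ℂ) i j)

/-- `Z_m = (I + P_m) Z_{m+1}` solves the system for `Z_m` if and only if `Z_{m+1}` solves the
system for `Z_{m+1}`. -/
theorem isSolution_one_add_P_iff (hs : s.Admissible) (hm1 : 1 ≤ m) (hm : m + 1 ≤ s.M) {X : ℝ}
    (hX : s.x₀ < X) (hu : ∀ x ≥ X, IsUnit (1 + s.P m x).det) (Z : ℝ → Fin n → ℂ) :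
    IsSolution (s.coeff m) X (fun x => (1 + s.P m x).mulVec (Z x)) ↔
      IsSolution (s.coeff (m + 1)) X Z := by
  have hD : ∀ x ≥ X, ∀ i j, HasDerivWithinAt (fun y => (1 + s.P m y) i j)
      (matDeriv (s.P m) x i j) (Ici X) x := fun x hx i j =>
    (hasDerivAt_one_add_P hs hm1 hm (hX.trans_le hx) i j).hasDerivWithinAt
  have hc : ∀ x ≥ X, (s.coeff m x).mulVec ((1 + s.P m x).mulVec (Z x))
      = (matDeriv (s.P m) x).mulVec (Z x)
        + (1 + s.P m x).mulVec ((s.coeff (m + 1) x).mulVec (Z x)) := fun x hx => by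
    rw [Matrix.mulVec_mulVec, Matrix.mulVec_mulVec,
      one_add_P_mul_coeff hs hm1 (hX.trans_le hx) (hu x hx), Matrix.sub_mulVec]
    abel
  constructor
  · intro h x hx
    -- Only `(I + P_m) Z` is known to be differentiable; `Z` inherits this through the inverse
    -- matrix.
    have hZ : DifferentiableWithinAt ℝ Z (Ici X) x := by
      rw [differentiableWithinAt_pi]
      intro i
      have hW := differentiableWithinAt_pi.1 (h x hx).differentiableWithinAt
      have h1 : DifferentiableWithinAt ℝ (fun y => ∑ j, (1 + s.P m y)⁻¹ i j *
          (1 + s.P m y).mulVec (Z y) j) (Ici X) x :=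
        DifferentiableWithinAt.fun_sum fun j _ => (differentiableAt_inv_apply
          (fun p q => (hasDerivAt_one_add_P hs hm1 hm (hX.trans_le hx) p q).differentiableAt)
          (hu x hx) i j).differentiableWithinAt.mul (hW j)
      have h2 : ∀ y ∈ Ici X, Z y i = ∑ j, (1 + s.P m y)⁻¹ i j *
          (1 + s.P m y).mulVec (Z y) j := fun y hy => by
        have : (1 + s.P m y)⁻¹.mulVec ((1 + s.P m y).mulVec (Z y)) = Z y := by
          rw [Matrix.mulVec_mulVec, Matrix.nonsing_inv_mul _ (hu y hy), Matrix.one_mulVec]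
        conv_lhs => rw [← this]
        rfl
      exact h1.congr h2 (h2 x hx)
    have hZ' := hZ.hasDerivWithinAt
    -- Product rule and equation give two values of one (possibly one-sided) derivative; `P_m' Z`
    -- cancels and `I + P_m` is inverted.
    have h3 := (uniqueDiffOn_Ici X x hx).eq_deriv _ (hasDerivWithinAt_mulVec (hD x hx) hZ')
      (h x hx)
    rw [hc x hx, add_right_inj] at h3
    have h4 := congrArg (fun v => (1 + s.P m x)⁻¹.mulVec v) h3
    simp only [Matrix.mulVec_mulVec, Matrix.nonsing_inv_mul_cancel_left _ _ (hu x hx),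
      Matrix.nonsing_inv_mul _ (hu x hx), Matrix.one_mulVec] at h4
    rwa [h4] at hZ'
  · intro h x hx
    have h1 := hasDerivWithinAt_mulVec (hD x hx) (h x hx)
    rwa [← hc x hx] at h1

theorem isSolution_prod (hs : s.Admissible) {X : ℝ} (hX : s.x₀ < X)
    (hu : ∀ m : ℕ, 1 ≤ m → m ≤ s.M - 1 → ∀ x ≥ X, IsUnit (1 + s.P m x).det) {p : ℕ}
    (hp : p ≤ s.M - 1) {Z : ℝ → Fin n → ℂ} (hZ : IsSolution (s.coeff (p + 1)) X Z) :
    IsSolution (s.coeff 1) X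
      (fun x => (((List.range p).map fun m => 1 + s.P (m + 1) x).prod).mulVec (Z x)) := by
  induction p generalizing Z with
  | zero => simpa using hZ
  | succ p ih =>
    have h := ih (by omega) ((isSolution_one_add_P_iff hs (by omega) (by omega) hX
      (hu (p + 1) (by omega) hp) Z).2 hZ)
    simpa only [List.range_succ, List.map_append, List.prod_append, List.map_cons, List.map_nil,
      List.prod_cons, List.prod_nil, mul_one, Matrix.mulVec_mulVec] using h

theorem isSolution_prodP (hs : s.Admissible) {X : ℝ} (hX : s.x₀ < X)
    (hu : ∀ m : ℕ, 1 ≤ m → m ≤ s.M - 1 → ∀ x ≥ X, IsUnit (1 + s.P m x).det)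
    {Z : ℝ → Fin n → ℂ} (hZ : IsSolution (s.coeff s.M) X Z) :
    IsSolution (s.coeff 1) X (fun x => (s.prodP x).mulVec (Z x)) := by
  refine isSolution_prod hs hX hu le_rfl ?_
  rwa [Nat.sub_add_cancel hs.one_le_M]

/-! ### Continuity of the coefficients -/

theorem continuousOn_ρ (hs : s.Admissible) : ContinuousOn s.ρ (Ioi s.x₀) := by
  have h := hs.ρ_order.continuousOn.inv₀ fun x hx => inv_ne_zero (hs.ρ_ne_zero x hx)
  exact h.congr fun x _ => (inv_inv (s.ρ x)).symm

theorem continuousOn_lam (hs : s.Admissible) : ContinuousOn s.lam (Ioi s.x₀) := by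
  have h := hs.lam_order.continuousOn.inv₀ fun x hx => inv_ne_zero (hs.lam_ne_zero x hx)
  exact h.congr fun x _ => (inv_inv (s.lam x)).symm

theorem continuousOn_Λ₀ (hs : s.Admissible) (i : Fin n) :
    ContinuousOn (fun x => s.Λ₀ x i) (Ioi s.x₀) := by
  by_cases h : i.val < s.N
  · simp only [Λ₀, h, if_true]
    exact (continuousOn_lam hs).mul continuousOn_const
  · simpa [Λ₀, h] using continuousOn_const

theorem StageOrder.continuousOn_φ {t : Stage n} (hs : s.Admissible) (ht : s.StageOrder m t)
    (i : Fin n) : ContinuousOn (fun x => t.φ x i) (Ioi s.x₀) :=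
  (φ_order_zero hs ht i).continuousOn

theorem StageOrder.continuousOn_Λmat {t : Stage n} (hs : s.Admissible) (ht : s.StageOrder m t) :
    ContinuousOn (s.Λmat t) (Ioi s.x₀) := by
  refine continuousOn_matrix fun i j => ?_
  by_cases h : i = j
  · subst h
    simp only [Λmat, Matrix.diagonal_apply_eq]
    exact (continuousOn_Λ₀ hs i).add (ht.continuousOn_φ hs i)
  · simpa [Λmat, h] using continuousOn_const

theorem continuousOn_expo (hs : s.Admissible) (k : Fin n) :
    ContinuousOn (s.expo k) (Ioi s.x₀) :=
  (continuousOn_ρ hs).mul ((continuousOn_Λ₀ hs k).add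
    ((stageOrder_stage hs hs.one_le_M le_rfl).continuousOn_φ hs k))

/-- The integral equation and the continuation argument need continuous coefficients. As `E_{m+1}`
contains `(I + P_m)⁻¹`, continuity is claimed only where these inverses exist. -/
theorem continuousOn_stage_E (hs : s.Admissible) {X : ℝ} (hX : s.x₀ < X)
    (hu : ∀ m : ℕ, 1 ≤ m → m ≤ s.M - 1 → ∀ x ≥ X, IsUnit (1 + s.P m x).det)
    (hm1 : 1 ≤ m) (hm : m ≤ s.M) : ContinuousOn (s.stage m).E (Ici X) := by
  have hsub : Ici X ⊆ Ioi s.x₀ := fun x hx => hX.trans_le hx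
  induction m, hm1 using Nat.le_induction with
  | base => simpa [stage] using (continuousOn_matrix hs.E_cont).mono hsub
  | succ m hm1 ih =>
    have hE := ih (by omega)
    have ht := stageOrder_stage hs hm1 (by omega : m ≤ s.M)
    have ht' := stageOrder_stage hs (by omega : 1 ≤ m + 1) hm
    have hP := Pmat_order hs hm1 ht hm
    have hPc := (MatDiffO.continuousOn hP).mono hsub
    have hV : ∀ j, 1 ≤ j → j ≤ s.M - m → ContinuousOn ((s.stage m).V j) (Ici X) :=
      fun j h1 h2 => (MatDiffO.continuousOn (ht.V_order j h1 h2)).mono hsub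
    have hR : ContinuousOn (s.Rmat m (s.stage m)) (Ici X) := by
      refine ContinuousOn.add (continuousOn_finsetSum _ fun j hj => ?_) hE
      rw [Finset.mem_Icc] at hj
      exact hV j hj.1 hj.2
    have hD := (inv_ρ_smul_deriv_order hs hm1 hm hP).continuousOn.mono hsub
    have hΛ := (ht.continuousOn_Λmat hs).mono hsub
    have hinv := continuousOn_matrix_inv (continuousOn_const.add hPc)
      (hu m hm1 (by omega))
    have hV1 := hV 1 le_rfl (by omega)
    have htr : ContinuousOn (s.transformed m (s.stage m)) (Ici X) :=
      hΛ.add (hinv.mul (((((hD.neg.add hV1).add (hΛ.mul hPc)).sub (hPc.mul hΛ)).add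
        (hR.sub hV1)).add (hR.mul hPc)))
    have hΛ' := (ht'.continuousOn_Λmat hs).mono hsub
    rw [stage_succ s hm1] at hΛ' ht' ⊢
    refine (htr.sub hΛ').sub (continuousOn_finsetSum _ fun j hj => ?_)
    rw [Finset.mem_Icc] at hj
    exact (MatDiffO.continuousOn (ht'.V_order j hj.1 hj.2)).mono hsub

theorem R_M_eq (s : System n) (x : ℝ) : s.R s.M x = (s.stage s.M).E x := by
  simp [R, Rmat]

end System

/-! ### Variation of constants for a scalar equation on `[a, ∞)` -/

/-- `J` assigns to each integrable `h` a solution of `η' = f η + h` on `[a, ∞)` that tends to `0`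
and is bounded by `C ∫ |h|`. -/
structure IsVariation (f : ℝ → ℂ) (a C : ℝ) (J : (ℝ → ℂ) → ℝ → ℂ) : Prop where
  hasDerivAt : ∀ h, Continuous h → ∀ x, HasDerivAt (J h) (f x * J h x + h x) x
  norm_le : ∀ h, Continuous h → IntegrableOn h (Ioi a) → ∀ x ≥ a,
    ‖J h x‖ ≤ C * ∫ t in Ioi a, ‖h t‖
  tendsto : ∀ h, Continuous h → IntegrableOn h (Ioi a) → Tendsto (J h) atTop (𝓝 0)
  sub : ∀ h₁ h₂, Continuous h₁ → Continuous h₂ → IntegrableOn h₁ (Ioi a) →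
    IntegrableOn h₂ (Ioi a) → ∀ x, J h₁ x - J h₂ x = J (fun t => h₁ t - h₂ t) x

section Variation

theorem tendsto_setIntegral_Ioi_zero {h : ℝ → ℝ} {a : ℝ} (hi : IntegrableOn h (Ioi a)) :
    Tendsto (fun x => ∫ t in Ioi x, h t) atTop (𝓝 0) := by
  have h2 := (intervalIntegral_tendsto_integral_Ioi a hi tendsto_id).const_sub
    (∫ t in Ioi a, h t)
  rw [sub_self] at h2
  refine h2.congr' ?_
  filter_upwards [eventually_ge_atTop a] with x hx
  rw [← intervalIntegral.integral_interval_add_Ioi (b := x) hi (hi.mono_set (Ioi_subset_Ioi hx))]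
  simp

variable {f Φ : ℝ → ℂ} {a C : ℝ}

theorem hasDerivAt_exp_mul_integral (hΦ : ∀ x, HasDerivAt Φ (f x) x) {h : ℝ → ℂ}
    (hh : Continuous h) (c : ℂ) (x : ℝ) :
    HasDerivAt (fun x => Complex.exp (Φ x) * ((∫ t in a..x, Complex.exp (-Φ t) * h t) - c))
      (f x * (Complex.exp (Φ x) * ((∫ t in a..x, Complex.exp (-Φ t) * h t) - c)) + h x) x := by
  have hΦc : Continuous Φ := continuous_iff_continuousAt.2 fun x => (hΦ x).continuousAt
  have hg : Continuous fun t => Complex.exp (-Φ t) * h t := by fun_prop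
  have h1 := intervalIntegral.integral_hasDerivAt_right (hg.intervalIntegrable a x)
    (hg.stronglyMeasurableAtFilter _ _) hg.continuousAt
  refine ((hΦ x).cexp.mul (h1.sub_const c)).congr_deriv ?_
  have h2 : Complex.exp (Φ x) * (Complex.exp (-Φ x) * h x) = h x := by
    rw [← mul_assoc, ← Complex.exp_add, add_neg_cancel, Complex.exp_zero, one_mul]
  rw [h2]
  ring

/-- The kernel `exp (Φ x - Φ t)`, `t ≤ x`, is bounded by `C` and tends to `0` for each fixed `t`;
dominated convergence yields the decay. -/
theorem isVariation_forward (hΦ : ∀ x, HasDerivAt Φ (f x) x)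
    (hC : ∀ t x, a ≤ t → t ≤ x → ‖Complex.exp (Φ x - Φ t)‖ ≤ C)
    (hlim : Tendsto (fun x => (Φ x).re) atTop atBot) :
    IsVariation f a C fun h x => Complex.exp (Φ x) * ∫ t in a..x, Complex.exp (-Φ t) * h t := by
  have hΦc : Continuous Φ := continuous_iff_continuousAt.2 fun x => (hΦ x).continuousAt
  have key : ∀ (h : ℝ → ℂ) (x : ℝ), x ≥ a →
      Complex.exp (Φ x) * ∫ t in a..x, Complex.exp (-Φ t) * h t
        = ∫ t in Ioi a, (Iic x).indicator (fun t => Complex.exp (Φ x - Φ t) * h t) t := by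
    intro h x hx
    rw [← intervalIntegral.integral_const_mul, intervalIntegral.integral_of_le hx,
      setIntegral_indicator measurableSet_Iic, Ioi_inter_Iic]
    simp only [← mul_assoc, ← Complex.exp_add, sub_eq_add_neg]
  have hbd : ∀ (h : ℝ → ℂ) (x : ℝ), ∀ᵐ t ∂(volume.restrict (Ioi a)),
      ‖(Iic x).indicator (fun t => Complex.exp (Φ x - Φ t) * h t) t‖ ≤ C * ‖h t‖ := by
    intro h x
    filter_upwards [ae_restrict_mem measurableSet_Ioi] with t ht
    have hC0 : 0 ≤ C := (norm_nonneg _).trans (hC t t (le_of_lt ht) le_rfl)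
    by_cases htx : t ≤ x
    · rw [indicator_of_mem (show t ∈ Iic x from htx), norm_mul]
      exact mul_le_mul_of_nonneg_right (hC t x (le_of_lt ht) htx) (norm_nonneg _)
    · rw [indicator_of_notMem (show t ∉ Iic x from htx), norm_zero]
      positivity
  refine ⟨fun h hh x => ?_, fun h hh hi x hx => ?_, fun h hh hi => ?_,
    fun h₁ h₂ hh₁ hh₂ _ _ x => ?_⟩
  · simpa using hasDerivAt_exp_mul_integral (a := a) hΦ hh 0 x
  · rw [key h x hx, ← integral_const_mul]
    exact norm_integral_le_of_norm_le (hi.norm.const_mul C) (hbd h x)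
  · have h1 : Tendsto (fun x => ∫ t in Ioi a,
        (Iic x).indicator (fun t => Complex.exp (Φ x - Φ t) * h t) t) atTop
        (𝓝 (∫ _ in Ioi a, (0 : ℂ))) := by
      refine tendsto_integral_filter_of_dominated_convergence (fun t => C * ‖h t‖)
        (Eventually.of_forall fun x => ?_) (Eventually.of_forall (hbd h))
        (hi.norm.const_mul C) (Eventually.of_forall fun t => ?_)
      · exact (Continuous.aestronglyMeasurable (by fun_prop)).indicator measurableSet_Iic
      · have h2 : Tendsto (fun x => Complex.exp (Φ x - Φ t) * h t) atTop (𝓝 0) := by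
          have h3 : Tendsto (fun x => Complex.exp (Φ x - Φ t)) atTop (𝓝 0) := by
            rw [Complex.tendsto_exp_nhds_zero_iff]
            simpa [sub_eq_add_neg] using tendsto_atBot_add_const_right atTop (-(Φ t).re) hlim
          simpa using h3.mul_const (h t)
        refine h2.congr' ?_
        filter_upwards [eventually_ge_atTop t] with x hx
        rw [indicator_of_mem (show t ∈ Iic x from hx)]
    rw [integral_zero] at h1
    refine h1.congr' ?_
    filter_upwards [eventually_ge_atTop a] with x hx using (key h x hx).symm
  · rw [← mul_sub, ← intervalIntegral.integral_sub
      (Continuous.intervalIntegrable (by fun_prop) _ _)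
      (Continuous.intervalIntegrable (by fun_prop) _ _)]
    simp only [mul_sub]

/-- The operator is `-∫_x^∞`, bounded by a tail of `∫ |h|`, so it decays without any decay of the
kernel. It is written as a difference of integrals from `a`, so that the derivative formula holds
for all real `x`. -/
theorem isVariation_backward (hΦ : ∀ x, HasDerivAt Φ (f x) x)
    (hC : ∀ x t, a ≤ x → x ≤ t → ‖Complex.exp (Φ x - Φ t)‖ ≤ C) :
    IsVariation f a C fun h x => Complex.exp (Φ x) * ((∫ t in a..x, Complex.exp (-Φ t) * h t)
      - ∫ t in Ioi a, Complex.exp (-Φ t) * h t) := by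
  have hΦc : Continuous Φ := continuous_iff_continuousAt.2 fun x => (hΦ x).continuousAt
  have hint : ∀ h : ℝ → ℂ, Continuous h → IntegrableOn h (Ioi a) →
      IntegrableOn (fun t => Complex.exp (-Φ t) * h t) (Ioi a) := by
    intro h hh hi
    refine Integrable.bdd_mul (c := ‖Complex.exp (-Φ a)‖ * C) hi
      (Continuous.aestronglyMeasurable (by fun_prop)) ?_
    filter_upwards [ae_restrict_mem measurableSet_Ioi] with t ht
    have h1 : Complex.exp (-Φ t) = Complex.exp (-Φ a) * Complex.exp (Φ a - Φ t) := by
      rw [← Complex.exp_add]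
      congr 1
      ring
    rw [h1, norm_mul]
    exact mul_le_mul_of_nonneg_left (hC a t le_rfl (le_of_lt ht)) (norm_nonneg _)
  have hle : ∀ h : ℝ → ℂ, Continuous h → IntegrableOn h (Ioi a) → ∀ x ≥ a,
      ‖Complex.exp (Φ x) * ((∫ t in a..x, Complex.exp (-Φ t) * h t)
        - ∫ t in Ioi a, Complex.exp (-Φ t) * h t)‖ ≤ C * ∫ t in Ioi x, ‖h t‖ := by
    intro h hh hi x hx
    have hs : Ioi x ⊆ Ioi a := Ioi_subset_Ioi hx
    rw [← intervalIntegral.integral_interval_add_Ioi (hint h hh hi) ((hint h hh hi).mono_set hs),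
      sub_add_cancel_left, mul_neg, norm_neg, ← integral_const_mul, ← integral_const_mul]
    refine norm_integral_le_of_norm_le ((hi.mono_set hs).norm.const_mul C) ?_
    filter_upwards [ae_restrict_mem measurableSet_Ioi] with t ht
    rw [← mul_assoc, ← Complex.exp_add, norm_mul, ← sub_eq_add_neg]
    exact mul_le_mul_of_nonneg_right (hC x t hx (le_of_lt ht)) (norm_nonneg _)
  have hC0 : 0 ≤ C := (norm_nonneg _).trans (hC a a le_rfl le_rfl)
  refine ⟨fun h hh x => ?_, fun h hh hi x hx => ?_, fun h hh hi => ?_,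
    fun h₁ h₂ hh₁ hh₂ hi₁ hi₂ x => ?_⟩
  · exact hasDerivAt_exp_mul_integral (a := a) hΦ hh _ x
  · refine (hle h hh hi x hx).trans (mul_le_mul_of_nonneg_left ?_ hC0)
    exact setIntegral_mono_set hi.norm (Eventually.of_forall fun t => norm_nonneg _)
      (Ioi_subset_Ioi hx).eventuallyLE
  · have h1 := (tendsto_setIntegral_Ioi_zero hi.norm).const_mul C
    rw [mul_zero] at h1
    refine squeeze_zero_norm' ?_ h1
    filter_upwards [eventually_ge_atTop a] with x hx using hle h hh hi x hx
  · rw [← mul_sub]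
    simp only [mul_sub (Complex.exp _) (h₁ _) (h₂ _)]
    rw [intervalIntegral.integral_sub
      (Continuous.intervalIntegrable (by fun_prop) _ _)
      (Continuous.intervalIntegrable (by fun_prop) _ _), integral_sub (hint h₁ hh₁ hi₁)
      (hint h₂ hh₂ hi₂)]
    congr 1
    ring

theorem IsVariation.mono {C' : ℝ} {J : (ℝ → ℂ) → ℝ → ℂ} (hJ : IsVariation f a C J)
    (h : C ≤ C') : IsVariation f a C' J :=
  ⟨hJ.hasDerivAt, fun g hg hi x hx => (hJ.norm_le g hg hi x hx).trans
    (mul_le_mul_of_nonneg_right h (integral_nonneg fun _ => norm_nonneg _)), hJ.tendsto, hJ.sub⟩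

theorem exists_primitive (hf : Continuous f) (X : ℝ) : ∃ Φ : ℝ → ℂ, (∀ x, HasDerivAt Φ (f x) x) ∧
    (∀ x, (Φ x).re = ∫ t in X..x, (f t).re) ∧
    ((∀ x, (f x).re ≤ 0) → Antitone fun x => (Φ x).re) ∧
    ((∀ x, 0 ≤ (f x).re) → Monotone fun x => (Φ x).re) := by
  have h1 : ∀ x, HasDerivAt (fun x => ∫ t in X..x, f t) (f x) x := fun x =>
    (hf.integral_hasStrictDerivAt X x).hasDerivAt
  have h2 : ∀ x, HasDerivAt (fun x => (∫ t in X..x, f t).re) (f x).re x := fun x =>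
    Complex.reCLM.hasFDerivAt.comp_hasDerivAt x (h1 x)
  refine ⟨fun x => ∫ t in X..x, f t, h1, fun x => ?_, fun h => ?_, fun h => ?_⟩
  · simpa using (Complex.reCLM.intervalIntegral_comp_comm (hf.intervalIntegrable X x)).symm
  · exact antitone_of_deriv_nonpos (fun x => (h2 x).differentiableAt)
      fun x => by rw [(h2 x).deriv]; exact h x
  · exact monotone_of_deriv_nonneg (fun x => (h2 x).differentiableAt)
      fun x => by rw [(h2 x).deriv]; exact h x

theorem norm_exp_sub_le_one {x t : ℝ} (h : (Φ x).re ≤ (Φ t).re) :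
    ‖Complex.exp (Φ x - Φ t)‖ ≤ 1 := by
  rw [Complex.norm_exp, Real.exp_le_one_iff, Complex.sub_re]
  linarith

/-- The sign condition alone provides a bounded solution operator on every `[a, ∞)`. -/
theorem exists_isVariation (hf : Continuous f) (X : ℝ)
    (hsign : (∀ x, (f x).re ≤ 0) ∨ (∀ x, 0 ≤ (f x).re)) :
    ∃ C, 0 ≤ C ∧ ∀ a ≥ X, ∃ J, IsVariation f a C J := by
  obtain ⟨Φ, hΦ, -, hanti, hmono⟩ := exists_primitive hf X
  rcases hsign with h | h
  -- A decreasing `Re Φ` either tends to `-∞` or has a limit `l`. In the second case the backward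
  -- kernel is at most `exp (Re Φ(X) - l)`, uniformly in `a ≥ X`; this uniformity allows `a` to be
  -- moved to the right later.
  · rcases tendsto_atTop_of_antitone (hanti h) with h1 | ⟨l, hl⟩
    · exact ⟨1, zero_le_one, fun a _ => ⟨_, isVariation_forward hΦ
        (fun t x _ htx => norm_exp_sub_le_one (hanti h htx)) h1⟩⟩
    · refine ⟨Real.exp ((Φ X).re - l), (Real.exp_pos _).le, fun a ha => ⟨_,
        isVariation_backward hΦ fun x t hx _ => ?_⟩⟩
      rw [Complex.norm_exp, Real.exp_le_exp, Complex.sub_re]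
      have h1 := hanti h (ha.le.trans hx)
      have h2 := (hanti h).le_of_tendsto hl t
      simp only at h1 h2
      linarith
  · exact ⟨1, zero_le_one, fun a _ => ⟨_, isVariation_backward hΦ
      fun x t _ hxt => norm_exp_sub_le_one (hmono h hxt)⟩⟩

/-- With divergent integrals the solution operator is bounded by `1`. -/
theorem exists_isVariation_one (hf : Continuous f) (X : ℝ)
    (hsign : (∀ x, (f x).re ≤ 0) ∨ (∀ x, 0 ≤ (f x).re))
    (hdiv : Tendsto (fun x => |∫ t in X..x, (f t).re|) atTop atTop ∨ ∀ x, (f x).re = 0) :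
    ∃ J, IsVariation f X 1 J := by
  obtain ⟨Φ, hΦ, hre, hanti, hmono⟩ := exists_primitive hf X
  have hback : (∀ x, 0 ≤ (f x).re) → ∃ J, IsVariation f X 1 J := fun h =>
    ⟨_, isVariation_backward hΦ fun x t _ hxt => norm_exp_sub_le_one (hmono h hxt)⟩
  rcases hsign with h | h
  · rcases hdiv with h1 | h1
    · refine ⟨_, isVariation_forward hΦ
        (fun t x _ htx => norm_exp_sub_le_one (hanti h htx)) ?_⟩
      refine (tendsto_neg_atTop_atBot.comp h1).congr' ?_
      filter_upwards [eventually_ge_atTop X] with x hx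
      have h2 : (Φ x).re ≤ 0 := by
        have := hanti h hx
        simp only [hre, intervalIntegral.integral_same] at this ⊢
        exact this
      simp only [Function.comp, ← hre]
      rw [abs_of_nonpos h2, neg_neg]
    -- When `Re f` vanishes the kernel has modulus `1` and does not decay, so integration must come
    -- from infinity.
    · exact hback fun x => (h1 x).ge
  · exact hback h

end Variation

/-! ### Levinson's integral equation as a contraction -/

section LinearSystems

open scoped BoundedContinuousFunction

variable {n : ℕ}

theorem norm_apply_le_maxNorm (A : Matrix (Fin n) (Fin n) ℂ) (i j : Fin n) :
    ‖A i j‖ ≤ maxNorm A :=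
  norm_le_pi_norm (fun p : Fin n × Fin n => A p.1 p.2) (i, j)

theorem maxNorm_nonneg (A : Matrix (Fin n) (Fin n) ℂ) : 0 ≤ maxNorm A := norm_nonneg _

theorem maxNorm_smul (c : ℂ) (A : Matrix (Fin n) (Fin n) ℂ) :
    maxNorm (c • A) = ‖c‖ * maxNorm A :=
  norm_smul c fun p : Fin n × Fin n => A p.1 p.2

theorem norm_mulVec_le (A : Matrix (Fin n) (Fin n) ℂ) (v : Fin n → ℂ) :
    ‖A.mulVec v‖ ≤ n * maxNorm A * ‖v‖ := by
  have h0 := maxNorm_nonneg A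
  refine (pi_norm_le_iff_of_nonneg (by positivity)).2 fun i => ?_
  refine (norm_sum_le Finset.univ fun j => A i j * v j).trans ?_
  have h : ∀ j ∈ Finset.univ, ‖A i j * v j‖ ≤ maxNorm A * ‖v‖ := fun j _ => by
    rw [norm_mul]
    exact mul_le_mul (norm_apply_le_maxNorm A i j) (norm_le_pi_norm v j) (norm_nonneg _) h0
  refine (Finset.sum_le_sum h).trans_eq ?_
  simp [mul_assoc]

theorem continuousOn_maxNorm {G : ℝ → Matrix (Fin n) (Fin n) ℂ} {S : Set ℝ}
    (hG : ∀ i j, ContinuousOn (fun t => G t i j) S) : ContinuousOn (fun t => maxNorm (G t)) S :=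
  (continuousOn_pi.2 fun p : Fin n × Fin n => hG p.1 p.2).norm

theorem integrableOn_maxNorm {G : ℝ → Matrix (Fin n) (Fin n) ℂ} {S : Set ℝ}
    (hS : MeasurableSet S) (hG : ∀ i j, ContinuousOn (fun t => G t i j) S)
    (hGi : ∀ i j, IntegrableOn (fun t => G t i j) S) :
    IntegrableOn (fun t => maxNorm (G t)) S := by
  refine Integrable.mono' (g := fun t => ∑ p : Fin n × Fin n, ‖G t p.1 p.2‖)
    (integrable_finsetSum _ fun p _ => (hGi p.1 p.2).norm)
    ((continuousOn_maxNorm hG).aestronglyMeasurable hS) (Eventually.of_forall fun t => ?_)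
  rw [Real.norm_of_nonneg (maxNorm_nonneg _)]
  refine (pi_norm_le_iff_of_nonneg (Finset.sum_nonneg fun _ _ => norm_nonneg _)).2 fun p => ?_
  exact Finset.single_le_sum (f := fun p : Fin n × Fin n => ‖G t p.1 p.2‖)
    (fun _ _ => norm_nonneg _) (Finset.mem_univ p)

/-- The integral equation of Levinson's theorem on `[a, ∞)`. -/
theorem exists_levinson_of_isVariation {F : Fin n → ℝ → ℂ} {G : ℝ → Matrix (Fin n) (Fin n) ℂ}
    {a C : ℝ} (hG : ∀ i j, Continuous fun t => G t i j)
    (hGi : ∀ i j, IntegrableOn (fun t => G t i j) (Ioi a))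
    {J : Fin n → (ℝ → ℂ) → ℝ → ℂ} (hJ : ∀ j, IsVariation (F j) a C (J j)) (hC : 0 ≤ C)
    (hsmall : n * (C * ∫ t in Ioi a, maxNorm (G t)) < 1) (k : Fin n) :
    ∃ η : ℝ → Fin n → ℂ, Tendsto η atTop (𝓝 0) ∧
      (∀ x ≥ a, HasDerivWithinAt η
        (fun j => F j x * η x j + (G x).mulVec (Pi.single k 1 + η x) j) (Ici a) x) ∧
      ∀ x ≥ a, ‖η x‖ ≤ C * (∫ t in Ioi a, maxNorm (G t)) /
        (1 - n * (C * ∫ t in Ioi a, maxNorm (G t))) := by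
  set I := ∫ t in Ioi a, maxNorm (G t) with hI
  set q := C * I with hq
  have hmi : IntegrableOn (fun t => maxNorm (G t)) (Ioi a) :=
    integrableOn_maxNorm measurableSet_Ioi (fun i j => (hG i j).continuousOn) hGi
  have hI0 : 0 ≤ I := integral_nonneg fun t => maxNorm_nonneg _
  have hq0 : 0 ≤ q := mul_nonneg hC hI0
  have hent : ∀ (v : ℝ → Fin n → ℂ), Continuous v → ∀ j, Continuous fun t => (G t).mulVec (v t) j :=
    fun v hv j => continuous_finsetSum Finset.univ fun i _ =>
      (hG j i).fun_mul (continuous_pi_iff.1 hv i)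
  have hint : ∀ (v : ℝ → Fin n → ℂ), Continuous v → ∀ c, (∀ t j, ‖(G t).mulVec (v t) j‖
      ≤ maxNorm (G t) * c) → ∀ j, IntegrableOn (fun t => (G t).mulVec (v t) j) (Ioi a) ∧
        ∀ x ≥ a, ‖J j (fun t => (G t).mulVec (v t) j) x‖ ≤ q * c := by
    intro v hv c hc j
    have h1 : IntegrableOn (fun t => (G t).mulVec (v t) j) (Ioi a) :=
      Integrable.mono' (hmi.mul_const c) (hent v hv j).aestronglyMeasurable
        (Eventually.of_forall fun t => hc t j)
    refine ⟨h1, fun x hx => ((hJ j).norm_le _ (hent v hv j) h1 x hx).trans ?_⟩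
    rw [hq, mul_assoc]
    refine mul_le_mul_of_nonneg_left ?_ hC
    rw [hI, ← integral_mul_const]
    exact integral_mono h1.norm (hmi.mul_const c) fun t => hc t j
  -- `G e_k` is a single column and costs no factor `n`; only `G η` does. Hence the numerator of the
  -- final bound is `q` and not `n q`.
  have hbd : ∀ (η : ℝ →ᵇ (Fin n → ℂ)) t j,
      ‖(G t).mulVec (Pi.single k 1 + η t) j‖ ≤ maxNorm (G t) * (1 + n * ‖η‖) := by
    intro η t j
    rw [Matrix.mulVec_add, Matrix.mulVec_single_one]
    refine (norm_add_le _ _).trans ?_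
    have h1 := norm_apply_le_maxNorm (G t) j k
    have h2 := (norm_le_pi_norm ((G t).mulVec (η t)) j).trans (norm_mulVec_le (G t) (η t))
    have h3 := mul_le_mul_of_nonneg_left (η.norm_coe_le_norm t)
      (mul_nonneg (Nat.cast_nonneg (α := ℝ) n) (maxNorm_nonneg (G t)))
    have h4 : ‖(G t).col k j‖ = ‖G t j k‖ := rfl
    rw [h4]
    linarith
  have hvc : ∀ η : ℝ →ᵇ (Fin n → ℂ), Continuous fun t => Pi.single k 1 + η t := fun η =>
    continuous_const.add η.continuous
  have hJc : ∀ (η : ℝ →ᵇ (Fin n → ℂ)) j,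
      Continuous (J j fun t => (G t).mulVec (Pi.single k 1 + η t) j) := fun η j =>
    continuous_iff_continuousAt.2 fun x => ((hJ j).hasDerivAt _ (hent _ (hvc η) j) x).continuousAt
  -- The operators are controlled only on `[a, ∞)`; freezing the argument at `a` gives a self-map of
  -- a complete space of functions on the whole line.
  let T : (ℝ →ᵇ (Fin n → ℂ)) → (ℝ →ᵇ (Fin n → ℂ)) := fun η =>
    BoundedContinuousFunction.ofNormedAddCommGroup
      (fun x j => J j (fun t => (G t).mulVec (Pi.single k 1 + η t) j) (max x a))
      (continuous_pi fun j => (hJc η j).comp (continuous_id.max continuous_const))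
      (q * (1 + n * ‖η‖)) fun x => (pi_norm_le_iff_of_nonneg (by positivity)).2 fun j =>
        (hint _ (hvc η) _ (hbd η) j).2 _ (le_max_right _ _)
  have hT : ∀ η x j, T η x j = J j (fun t => (G t).mulVec (Pi.single k 1 + η t) j) (max x a) :=
    fun _ _ _ => rfl
  have hcontr : ContractingWith (Real.toNNReal (n * q)) T := by
    refine ⟨by rwa [Real.toNNReal_lt_one], LipschitzWith.of_dist_le_mul fun η₁ η₂ => ?_⟩
    rw [Real.coe_toNNReal _ (by positivity)]
    refine (BoundedContinuousFunction.dist_le (by positivity)).2 fun x => ?_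
    refine (dist_pi_le_iff (by positivity)).2 fun j => ?_
    rw [hT, hT, dist_eq_norm, (hJ j).sub _ _ (hent _ (hvc η₁) j) (hent _ (hvc η₂) j)
      (hint _ (hvc η₁) _ (hbd η₁) j).1 (hint _ (hvc η₂) _ (hbd η₂) j).1]
    have h1 : (fun t => (G t).mulVec (Pi.single k 1 + η₁ t) j
        - (G t).mulVec (Pi.single k 1 + η₂ t) j)
        = fun t => (G t).mulVec (η₁ t - η₂ t) j := by
      funext t
      simp [Matrix.mulVec_add, Matrix.mulVec_sub]
    rw [h1]
    refine ((hint (fun t => η₁ t - η₂ t) (η₁.continuous.sub η₂.continuous) (n * dist η₁ η₂)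
      (fun t i => ?_) j).2 _ (le_max_right _ _)).trans_eq (by ring)
    have h2 := (norm_le_pi_norm _ i).trans (norm_mulVec_le (G t) (η₁ t - η₂ t))
    have h3 := mul_le_mul_of_nonneg_left (η₁.dist_coe_le_dist (g := η₂) t)
      (mul_nonneg (Nat.cast_nonneg (α := ℝ) n) (maxNorm_nonneg (G t)))
    rw [dist_eq_norm (η₁ t)] at h3
    linarith
  obtain ⟨η, hη⟩ : ∃ η, T η = η := ⟨_, hcontr.fixedPoint_isFixedPt⟩
  have hfix : ∀ x ≥ a, ∀ j, η x j = J j (fun t => (G t).mulVec (Pi.single k 1 + η t) j) x :=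
    fun x hx j => by
      conv_lhs => rw [← hη, hT, max_eq_left hx]
  refine ⟨η, tendsto_pi_nhds.2 fun j => ?_, fun x hx => hasDerivWithinAt_pi.2 fun j => ?_,
    fun x hx => ?_⟩
  · refine ((hJ j).tendsto _ (hent _ (hvc η) j) (hint _ (hvc η) _ (hbd η) j).1).congr' ?_
    filter_upwards [eventually_ge_atTop a] with x hx using (hfix x hx j).symm
  · have h1 := ((hJ j).hasDerivAt _ (hent _ (hvc η) j) x).hasDerivWithinAt (s := Ici a)
    rw [← hfix x hx j] at h1
    exact h1.congr (fun y hy => hfix y hy j) (hfix x hx j)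
  -- The fixed point equation bounds `‖η‖` by itself; solving with `n q < 1` gives `q / (1 - n q)`.
  · have h1 : ‖η‖ ≤ q * (1 + n * ‖η‖) := by
      refine (BoundedContinuousFunction.norm_le (by positivity)).2 fun x => ?_
      have h2 : ‖T η x‖ ≤ q * (1 + n * ‖η‖) :=
        (pi_norm_le_iff_of_nonneg (by positivity)).2 fun j =>
          (hint _ (hvc η) _ (hbd η) j).2 _ (le_max_right _ _)
      rwa [hη] at h2
    refine (η.norm_coe_le_norm x).trans ?_
    rw [le_div_iff₀ (by linarith)]
    linarith

/-! ### Continuation of solutions of linear systems -/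

/-- For a linear equation the admissible Picard–Lindelöf step depends on the coefficient bound `c`
alone and not on the size of the solution, so steps of fixed length can be repeated. -/
theorem exists_isSolution_step {A : ℝ → Matrix (Fin n) (Fin n) ℂ} {b b' c : ℝ}
    (hA : ∀ i j, ContinuousOn (fun t => A t i j) (Icc b' b)) (hb : b' ≤ b)
    (hc : ∀ t ∈ Icc b' b, n * maxNorm (A t) ≤ c) (hc0 : 0 ≤ c) (hδ : c * (b - b') ≤ 1 / 2)
    {Z : ℝ → Fin n → ℂ} (hZ : IsSolution A b Z) :
    ∃ Z' : ℝ → Fin n → ℂ, IsSolution A b' Z' ∧ ∀ x ≥ b, Z' x = Z x := by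
  have hR : 0 ≤ ‖Z b‖ + 1 := by positivity
  -- On the ball of radius `‖Z b‖ + 1` about `Z b` the speed is at most `c (2 ‖Z b‖ + 1)`; over a
  -- time of at most `1 / (2c)` the solution stays inside.
  have hPL : IsPicardLindelof (fun t z => (A t).mulVec z) (⟨b, hb, le_rfl⟩ : Icc b' b) (Z b)
      (Real.toNNReal (‖Z b‖ + 1)) 0 (Real.toNNReal (c * (2 * ‖Z b‖ + 1))) (Real.toNNReal c) := by
    refine ⟨fun t ht => ?_, fun z _ => ?_, fun t ht z hz => ?_, ?_⟩
    · refine (LipschitzWith.of_dist_le_mul fun z w => ?_).lipschitzOnWith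
      rw [Real.coe_toNNReal _ hc0, dist_eq_norm, dist_eq_norm, ← Matrix.mulVec_sub]
      exact (norm_mulVec_le _ _).trans (mul_le_mul_of_nonneg_right (hc t ht) (norm_nonneg _))
    · exact continuousOn_pi.2 fun i => continuousOn_finsetSum Finset.univ fun j _ =>
        (hA i j).fun_mul (continuousOn_const (c := z j))
    · rw [Real.coe_toNNReal _ (by positivity)]
      rw [Metric.mem_closedBall, Real.coe_toNNReal _ hR, dist_eq_norm] at hz
      have h1 : ‖z‖ ≤ 2 * ‖Z b‖ + 1 := by
        have := norm_le_norm_add_norm_sub' z (Z b)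
        linarith
      exact (norm_mulVec_le _ _).trans (mul_le_mul (hc t ht) h1 (norm_nonneg _) hc0)
    · rw [Real.coe_toNNReal _ (by positivity), Real.coe_toNNReal _ hR, sub_self,
        max_eq_right (by linarith), NNReal.coe_zero, sub_zero]
      have := mul_le_mul_of_nonneg_right hδ (by positivity : 0 ≤ 2 * ‖Z b‖ + 1)
      nlinarith [norm_nonneg (Z b)]
  obtain ⟨α, hαb, hα⟩ := hPL.exists_eq_forall_mem_Icc_hasDerivWithinAt₀
  have hZ' : ∀ x ≥ b, (if x ≤ b then α x else Z x) = Z x := fun x hx => by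
    split_ifs with h
    · rw [le_antisymm h hx]
      exact hαb
    · rfl
  refine ⟨fun x => if x ≤ b then α x else Z x, fun x hx => ?_, hZ'⟩
  have h1 : x ≤ b → HasDerivWithinAt (fun x => if x ≤ b then α x else Z x)
      ((A x).mulVec (if x ≤ b then α x else Z x)) (Icc b' b) x := fun h => by
    rw [if_pos h]
    exact (hα x ⟨hx, h⟩).congr (fun y hy => if_pos hy.2) (if_pos h)
  have h2 : b ≤ x → HasDerivWithinAt (fun x => if x ≤ b then α x else Z x)
      ((A x).mulVec (if x ≤ b then α x else Z x)) (Ici b) x := fun h => by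
    rw [hZ' x h]
    exact (hZ x h).congr (fun y hy => hZ' y hy) (hZ' x h)
  rcases lt_trichotomy x b with h | h | h
  · refine (h1 h.le).mono_of_mem_nhdsWithin ?_
    filter_upwards [self_mem_nhdsWithin, mem_nhdsWithin_of_mem_nhds (Iio_mem_nhds h)] with y h3 h4
      using ⟨h3, le_of_lt h4⟩
  · refine ((h1 h.le).union (h2 h.ge)).mono fun y hy => ?_
    rcases le_total y b with h3 | h3
    · exact Or.inl ⟨hy, h3⟩
    · exact Or.inr h3
  · refine (h2 h.le).mono_of_mem_nhdsWithin ?_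
    filter_upwards [mem_nhdsWithin_of_mem_nhds (Ioi_mem_nhds h)] with y h3
    exact le_of_lt (mem_Ioi.1 h3)

/-- A solution of a linear system with continuous coefficients can be continued backwards. -/
theorem exists_isSolution_extend {A : ℝ → Matrix (Fin n) (Fin n) ℂ} {X Y : ℝ}
    (hA : ∀ i j, ContinuousOn (fun t => A t i j) (Icc X Y)) (hXY : X ≤ Y)
    {Z : ℝ → Fin n → ℂ} (hZ : IsSolution A Y Z) :
    ∃ Z' : ℝ → Fin n → ℂ, IsSolution A X Z' ∧ ∀ x ≥ Y, Z' x = Z x := by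
  obtain ⟨c₀, hc₀⟩ := isCompact_Icc.exists_bound_of_continuousOn
    (continuousOn_const (c := (n : ℝ)) |>.mul (continuousOn_maxNorm hA))
  set c := |c₀| + 1 with hcdef
  have hc0 : 0 < c := by positivity
  have hc : ∀ t ∈ Icc X Y, n * maxNorm (A t) ≤ c := fun t ht =>
    (le_abs_self _).trans ((hc₀ t ht).trans (by linarith [le_abs_self c₀]))
  have hstep : ∀ p : ℕ, ∃ Z' : ℝ → Fin n → ℂ,
      IsSolution A (max X (Y - p * (1 / (2 * c)))) Z' ∧ ∀ x ≥ Y, Z' x = Z x := by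
    intro p
    induction p with
    | zero => exact ⟨Z, by simpa [hXY] using hZ, fun _ _ => rfl⟩
    | succ p ih =>
      obtain ⟨Z₁, h1, h2⟩ := ih
      have hδ : 0 < 1 / (2 * c) := by positivity
      have hY : max X (Y - p * (1 / (2 * c))) ≤ Y := max_le hXY (by
        have : 0 ≤ (p : ℝ) * (1 / (2 * c)) := by positivity
        linarith)
      have hle : max X (Y - (p + 1 : ℕ) * (1 / (2 * c))) ≤ max X (Y - p * (1 / (2 * c))) :=
        max_le_max le_rfl (by push_cast; linarith)
      have hsub : Icc (max X (Y - (p + 1 : ℕ) * (1 / (2 * c)))) (max X (Y - p * (1 / (2 * c))))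
          ⊆ Icc X Y := Icc_subset_Icc (le_max_left _ _) hY
      have hlen : max X (Y - p * (1 / (2 * c))) - max X (Y - (p + 1 : ℕ) * (1 / (2 * c)))
          ≤ 1 / (2 * c) := by
        rw [sub_le_iff_le_add]
        refine max_le (by linarith [le_max_left X (Y - (p + 1 : ℕ) * (1 / (2 * c)))]) ?_
        have := le_max_right X (Y - (p + 1 : ℕ) * (1 / (2 * c)))
        push_cast at this ⊢
        linarith
      obtain ⟨Z₂, h3, h4⟩ := exists_isSolution_step (fun i j => (hA i j).mono hsub) hle
        (fun t ht => hc t (hsub ht)) hc0.le ((mul_le_mul_of_nonneg_left hlen hc0.le).trans_eq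
          (by field_simp)) h1
      exact ⟨Z₂, h3, fun x hx => (h4 x (hY.trans hx)).trans (h2 x hx)⟩
  obtain ⟨p, hp⟩ := exists_nat_ge ((Y - X) * (2 * c))
  obtain ⟨Z', h1, h2⟩ := hstep p
  refine ⟨Z', ?_, h2⟩
  have h3 : Y - p * (1 / (2 * c)) ≤ X := by
    rw [mul_one_div, sub_le_comm, le_div_iff₀ (by positivity)]
    exact hp
  rwa [max_eq_left h3] at h1

end LinearSystems

namespace System

variable {n : ℕ} {s : System n}

/-! ### Asymptotic solutions -/

theorem coeff_M_mulVec (s : System n) (x : ℝ) (v : Fin n → ℂ) (j : Fin n) :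
    (s.coeff s.M x).mulVec v j
      = s.expo j x * v j + (s.ρ x • s.R s.M x).mulVec v j := by
  rw [coeff, smul_add, Matrix.add_mulVec, Pi.add_apply, Λ, Λmat, Matrix.smul_mulVec, Pi.smul_apply,
    Matrix.mulVec_diagonal, smul_eq_mul, expo, mul_assoc]

/-- Splitting off the exponential shifts the `j`-th diagonal entry by the `k`-th, leaving `F_jk`,
and `F_kk = 0` makes `e_k` drop out. The exponent starts at `X` even if the equation is used only
from `Y` on. -/
theorem isSolution_levinsonForm (hs : s.Admissible) {X Y : ℝ} (hX : s.x₀ < X) (hXY : X ≤ Y)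
    {k : Fin n} {η : ℝ → Fin n → ℂ}
    (hη : ∀ x ≥ Y, HasDerivWithinAt η (fun j => s.F j k x * η x j
      + (s.ρ x • s.R s.M x).mulVec (Pi.single k 1 + η x) j) (Ici Y) x) :
    IsSolution (s.coeff s.M) Y (s.levinsonForm X k η) := by
  intro x hx
  have hx0 : s.x₀ < x := hX.trans_le (hXY.trans hx)
  have hc := continuousOn_expo hs k
  have hint : IntervalIntegrable (s.expo k) volume X x := by
    refine (hc.mono fun y hy => ?_).intervalIntegrable
    rw [uIcc_of_le (hXY.trans hx)] at hy
    exact hX.trans_le hy.1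
  have h1 := (intervalIntegral.integral_hasDerivAt_right hint
    (hc.stronglyMeasurableAtFilter isOpen_Ioi x hx0)
    (hc.continuousAt (Ioi_mem_nhds hx0))).cexp.hasDerivWithinAt (s := Ici Y)
  rw [hasDerivWithinAt_pi]
  intro j
  have h2 := h1.fun_mul ((hasDerivWithinAt_pi.1 (hη x hx) j).const_add
    ((Pi.single k 1 : Fin n → ℂ) j))
  refine h2.congr_deriv ?_
  rw [coeff_M_mulVec, levinsonForm, Matrix.mulVec_smul, Pi.smul_apply, Pi.smul_apply, smul_eq_mul,
    smul_eq_mul, Pi.add_apply, F]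
  have h3 : s.expo k x * (Pi.single k 1 : Fin n → ℂ) j
      = s.expo j x * (Pi.single k 1 : Fin n → ℂ) j := by
    by_cases h : j = k
    · rw [h]
    · simp [h]
  linear_combination Complex.exp (∫ t in X..x, s.expo k t) * h3

section Extended

variable {X : ℝ}

/-- The scalar theory assumes continuity on the whole line; freezing coefficients to the left of `X`
provides it and preserves sign conditions. -/
theorem continuous_comp_max {f : ℝ → ℂ} (hf : ContinuousOn f (Ici X)) :
    Continuous fun x => f (max x X) :=
  hf.comp_continuous (continuous_id.max continuous_const) fun x => le_max_right x X

theorem continuousOn_F (hs : s.Admissible) (j k : Fin n) :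
    ContinuousOn (s.F j k) (Ioi s.x₀) :=
  (continuousOn_expo hs j).sub (continuousOn_expo hs k)

theorem continuousOn_ρ_smul_R (hs : s.Admissible) (hX : s.x₀ < X)
    (hu : ∀ m : ℕ, 1 ≤ m → m ≤ s.M - 1 → ∀ x ≥ X, IsUnit (1 + s.P m x).det) :
    ContinuousOn (fun x => s.ρ x • s.R s.M x) (Ici X) := by
  have h := continuousOn_stage_E hs hX hu hs.one_le_M le_rfl
  simp only [R_M_eq]
  exact ((continuousOn_ρ hs).mono fun x hx => hX.trans_le hx).smul h

theorem setIntegral_maxNorm_comp_max (s : System n) (X : ℝ) :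
    ∫ t in Ioi X, maxNorm (s.ρ (max t X) • s.R s.M (max t X)) = s.errorIntegral X := by
  refine setIntegral_congr_fun measurableSet_Ioi fun t ht => ?_
  simp only [max_eq_left (le_of_lt (mem_Ioi.1 ht)), maxNorm_smul]

/-- Levinson's theorem on `[Y, ∞)`, for a given family of scalar solution operators. -/
theorem exists_levinsonForm (hs : s.Admissible) (hX : s.x₀ < X)
    (hu : ∀ m : ℕ, 1 ≤ m → m ≤ s.M - 1 → ∀ x ≥ X, IsUnit (1 + s.P m x).det)
    (hi : ∀ i j, IntegrableOn (fun x => s.ρ x * s.R s.M x i j) (Ioi X)) {Y C : ℝ} (hXY : X ≤ Y)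
    (hC : 0 ≤ C) (k : Fin n)
    (hJ : ∀ j, ∃ J, IsVariation (fun x => s.F j k (max x X)) Y C J)
    (hsmall : n * (C * ∫ t in Ioi Y, maxNorm (s.ρ (max t X) • s.R s.M (max t X))) < 1) :
    ∃ η : ℝ → Fin n → ℂ, Tendsto η atTop (𝓝 0) ∧
      IsSolution (s.coeff s.M) Y (s.levinsonForm X k η) ∧
      ∀ x ≥ Y, ‖η x‖ ≤ C * (∫ t in Ioi Y, maxNorm (s.ρ (max t X) • s.R s.M (max t X))) /
        (1 - n * (C * ∫ t in Ioi Y, maxNorm (s.ρ (max t X) • s.R s.M (max t X)))) := by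
  choose J hJ using hJ
  have hG := continuousOn_ρ_smul_R hs hX hu
  obtain ⟨η, h1, h2, h3⟩ := exists_levinson_of_isVariation
    (G := fun t => s.ρ (max t X) • s.R s.M (max t X))
    (fun i j => continuous_comp_max (continuousOn_matrix_apply hG i j))
    (fun i j => ((hi i j).congr_fun (fun t ht => by
      simp only [max_eq_left (le_of_lt (mem_Ioi.1 ht)), Matrix.smul_apply, smul_eq_mul])
      measurableSet_Ioi).mono_set (Ioi_subset_Ioi hXY)) hJ hC hsmall k
  refine ⟨η, h1, isSolution_levinsonForm hs hX hXY fun x hx => ?_, h3⟩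
  simpa only [max_eq_left (hXY.trans hx)] using h2 x hx

theorem sign_comp_max (hd : s.Dichotomy X) (j k : Fin n) :
    (∀ x, (s.F j k (max x X)).re ≤ 0) ∨ (∀ x, 0 ≤ (s.F j k (max x X)).re) :=
  (hd j k).imp (fun h x => h _ (le_max_right x X)) fun h x => h _ (le_max_right x X)

theorem continuous_F_comp_max (hs : s.Admissible) (hX : s.x₀ < X) (j k : Fin n) :
    Continuous fun x => s.F j k (max x X) :=
  continuous_comp_max ((continuousOn_F hs j k).mono fun _ hx => hX.trans_le hx)

/-- The asymptotic solutions under the sign condition. -/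
theorem exists_asymptotic_solution (hs : s.Admissible) (hX : s.x₀ < X)
    (hu : ∀ m : ℕ, 1 ≤ m → m ≤ s.M - 1 → ∀ x ≥ X, IsUnit (1 + s.P m x).det)
    (hi : ∀ i j, IntegrableOn (fun x => s.ρ x * s.R s.M x i j) (Ioi X)) (hd : s.Dichotomy X)
    (k : Fin n) : ∃ η : ℝ → Fin n → ℂ, Tendsto η atTop (𝓝 0) ∧
      IsSolution (s.coeff s.M) X (s.levinsonForm X k η) := by
  choose C hC0 hC using fun j => exists_isVariation (continuous_F_comp_max hs hX j k) X
    (sign_comp_max hd j k)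
  have hG := continuousOn_ρ_smul_R hs hX hu
  have hmi : IntegrableOn (fun t => maxNorm (s.ρ (max t X) • s.R s.M (max t X))) (Ioi X) := by
    refine integrableOn_maxNorm measurableSet_Ioi (fun i j =>
      (continuous_comp_max (continuousOn_matrix_apply hG i j)).continuousOn) fun i j =>
      (hi i j).congr_fun (fun t ht => ?_) measurableSet_Ioi
    simp only [max_eq_left (le_of_lt (mem_Ioi.1 ht)), Matrix.smul_apply, smul_eq_mul]
  have hlim := ((tendsto_setIntegral_Ioi_zero hmi).const_mul (∑ j, C j)).const_mul (n : ℝ)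
  rw [mul_zero, mul_zero] at hlim
  -- The sum of the `C j` serves as a common constant independent of the starting point, so a small
  -- enough tail of the integral makes the map a contraction.
  obtain ⟨Y, hY, hXY⟩ := ((hlim.eventually_lt_const one_pos).and (eventually_ge_atTop X)).exists
  obtain ⟨η, h1, h2, -⟩ := exists_levinsonForm hs hX hu hi hXY
    (Finset.sum_nonneg fun j _ => hC0 j) k (fun j => by
      obtain ⟨J, hJ⟩ := hC j Y hXY
      exact ⟨J, hJ.mono (Finset.single_le_sum (fun i _ => hC0 i) (Finset.mem_univ j))⟩) hY
  have hA : ContinuousOn (s.coeff s.M) (Ici X) := by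
    have hsub : Ici X ⊆ Ioi s.x₀ := fun x hx => hX.trans_le hx
    have h := (((continuousOn_ρ hs).mono hsub).smul
      (((stageOrder_stage hs hs.one_le_M le_rfl).continuousOn_Λmat hs).mono hsub)).add hG
    refine h.congr fun x _ => ?_
    rw [coeff, smul_add]
    rfl
  obtain ⟨Z, h3, h4⟩ := exists_isSolution_extend (fun i j =>
    (continuousOn_matrix_apply hA i j).mono Icc_subset_Ici_self) hXY h2
  -- The continued solution is put in the required form by solving for `η`; beyond `Y` this is the
  -- old `η`, so the limit persists.
  refine ⟨fun x => Complex.exp (-∫ t in X..x, s.expo k t) • Z x - Pi.single k 1, ?_, ?_⟩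
  · refine h1.congr' ?_
    filter_upwards [eventually_ge_atTop Y] with x hx
    rw [h4 x hx, levinsonForm, smul_smul, ← Complex.exp_add, neg_add_cancel, Complex.exp_zero,
      one_smul, add_sub_cancel_left]
  · convert h3 using 1
    funext x
    rw [levinsonForm, add_sub_cancel, smul_smul, ← Complex.exp_add, add_neg_cancel,
      Complex.exp_zero, one_smul]

/-- The asymptotic solutions with an explicit error bound. -/
theorem exists_asymptotic_solution_norm_le (hs : s.Admissible) (hX : s.x₀ < X)
    (hu : ∀ m : ℕ, 1 ≤ m → m ≤ s.M - 1 → ∀ x ≥ X, IsUnit (1 + s.P m x).det)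
    (hi : ∀ i j, IntegrableOn (fun x => s.ρ x * s.R s.M x i j) (Ioi X)) (hd : s.Dichotomy X)
    (hdiv : s.Divergent X) (hsmall : n * s.errorIntegral X < 1)
    (k : Fin n) : ∃ η : ℝ → Fin n → ℂ, Tendsto η atTop (𝓝 0) ∧
      (∀ x ≥ X, ‖η x‖ ≤ s.errorIntegral X / (1 - n * s.errorIntegral X)) ∧
      IsSolution (s.coeff s.M) X (s.levinsonForm X k η) := by
  have hJ : ∀ j, ∃ J, IsVariation (fun x => s.F j k (max x X)) X 1 J := fun j => by
    refine exists_isVariation_one (continuous_F_comp_max hs hX j k) X (sign_comp_max hd j k) ?_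
    by_cases hjk : j = k
    · right
      simp [hjk, F]
    · refine (hdiv j k hjk).imp (fun h => h.congr' ?_) fun h x => h _ (le_max_right x X)
      filter_upwards [eventually_ge_atTop X] with x hx
      congr 1
      refine intervalIntegral.integral_congr fun t ht => ?_
      rw [uIcc_of_le hx] at ht
      simp only [max_eq_left ht.1]
  -- With constant `1` and `n I_X < 1` the contraction works from `X` itself; no continuation is
  -- needed and the bound holds on all of `[X, ∞)`.
  have h := exists_levinsonForm hs hX hu hi le_rfl zero_le_one k hJ
  simp only [one_mul, setIntegral_maxNorm_comp_max] at h
  obtain ⟨η, h1, h2, h3⟩ := h hsmall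
  exact ⟨η, h1, h3, h2⟩

end Extended

end System

end LevinsonAlg

/-! ### Assembly of the conclusions -/

theorem mainTheorem2 {n : ℕ} (s : LevinsonAlg.System n) (hs : s.Admissible)
    (hK : s.K = 0 → s.InverseFactor) :
    -- orders of magnitude and removal of the dominant term, for `1 ≤ m ≤ M - 1`
    (∀ m : ℕ, 1 ≤ m → m ≤ s.M - 1 →
      (∀ x > s.x₀, ∀ i, (s.stage m).V 1 x i i = 0) ∧
      (∀ j : ℕ, 1 ≤ j → j ≤ s.M - m →
        LevinsonAlg.MatO (-(((m : ℝ) + j - 1) * s.a)) ((s.stage m).V j)) ∧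
      LevinsonAlg.MatO (-(m * s.a)) (s.P m) ∧
      (∀ᶠ x in Filter.atTop, IsUnit (1 + s.P m x).det) ∧
      (∀ x > s.x₀,
        -((s.ρ x)⁻¹ • LevinsonAlg.matDeriv (s.P m) x) + (s.stage m).V 1 x
            + s.Λ m x * s.P m x - s.P m x * s.Λ m x
          = (if s.K = 0 then 0
              else -((s.ρ x)⁻¹ • LevinsonAlg.matDeriv (s.Qmat m (s.stage m)) x))
            - (s.ρ x)⁻¹ • LevinsonAlg.matDeriv (s.Qtmat m (s.stage m)) x
            + s.Umat (s.stage m) x + s.Tbar m (s.stage m) x + s.Ttil m (s.stage m) x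
            + s.Tmat m (s.stage m) x) ∧
      LevinsonAlg.MatO (-(((m : ℝ) + s.K) * s.a))
        (fun x => (s.ρ x)⁻¹ • LevinsonAlg.matDeriv (s.P m) x) ∧
      LevinsonAlg.MatO (-(((m : ℝ) + s.K + s.L) * s.a))
        (fun x => (s.ρ x)⁻¹ • LevinsonAlg.matDeriv (s.Qtmat m (s.stage m)) x) ∧
      LevinsonAlg.MatO (-(((m : ℝ) + s.L) * s.a)) (s.Umat (s.stage m)) ∧
      LevinsonAlg.MatO (-(((m : ℝ) + s.L) * s.a)) (s.Tbar m (s.stage m)) ∧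
      LevinsonAlg.MatO (-(((m : ℝ) + s.L + 1) * s.a)) (s.Ttil m (s.stage m)) ∧
      LevinsonAlg.MatO (-(((m : ℝ) + 1) * s.a)) (s.Tmat m (s.stage m))) ∧
    -- the remainder and the diagonal part, for `1 ≤ m ≤ M`
    (∀ m : ℕ, 1 ≤ m → m ≤ s.M →
      LevinsonAlg.MatO (-(s.M * s.a)) (s.stage m).E ∧
      ∀ i, (fun x => (s.stage m).φ x i - s.φlim i) =O[Filter.atTop]
        fun x : ℝ => x ^ (-s.a)) ∧
    (∀ x, s.R s.M x = (s.stage s.M).E x) ∧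
    -- `Z_m = (I + P_m) Z_{m+1}` takes the system for `Z_m` into the one for `Z_{m+1}`
    (∀ m : ℕ, 1 ≤ m → m ≤ s.M - 1 → ∀ X > s.x₀,
      (∀ x ≥ X, IsUnit (1 + s.P m x).det) → ∀ Z : ℝ → Fin n → ℂ,
        (LevinsonAlg.IsSolution (s.coeff m) X (fun x => (1 + s.P m x).mulVec (Z x)) ↔
          LevinsonAlg.IsSolution (s.coeff (m + 1)) X Z)) ∧
    -- the asymptotic solutions
    (∀ X > s.x₀,
      (∀ m : ℕ, 1 ≤ m → m ≤ s.M - 1 → ∀ x ≥ X, IsUnit (1 + s.P m x).det) →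
      (∀ i j, MeasureTheory.IntegrableOn (fun x => s.ρ x * s.R s.M x i j) (Set.Ioi X)) →
      s.Dichotomy X →
      (∀ k, ∃ η : ℝ → Fin n → ℂ,
        Filter.Tendsto η Filter.atTop (nhds 0) ∧
        LevinsonAlg.IsSolution (s.coeff s.M) X (s.levinsonForm X k η) ∧
        LevinsonAlg.IsSolution (s.coeff 1) X
          (fun x => (s.prodP x).mulVec (s.levinsonForm X k η x))) ∧
      (s.Divergent X → n * s.errorIntegral X < 1 →
        ∀ k, ∃ η : ℝ → Fin n → ℂ,
          Filter.Tendsto η Filter.atTop (nhds 0) ∧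
          (∀ x ≥ X, ‖η x‖ ≤ s.errorIntegral X / (1 - n * s.errorIntegral X)) ∧
          LevinsonAlg.IsSolution (s.coeff s.M) X (s.levinsonForm X k η) ∧
          LevinsonAlg.IsSolution (s.coeff 1) X
            (fun x => (s.prodP x).mulVec (s.levinsonForm X k η x)))) := by
  refine ⟨fun m hm1 hm => ?_, fun m hm1 hm => ?_, s.R_M_eq, fun m hm1 hm X hX hu Z => ?_,
    fun X hX hu hi hd => ⟨fun k => ?_, fun hdiv hsmall k => ?_⟩⟩
  · have hm' : m + 1 ≤ s.M := by omega
    have ht := LevinsonAlg.System.stageOrder_stage hs hm1 (by omega : m ≤ s.M)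
    have hP := LevinsonAlg.System.Pmat_order hs hm1 ht hm'
    have hma : -((m : ℝ) * s.a) < 0 := by
      have : (0 : ℝ) < m := by exact_mod_cast hm1
      have := mul_pos this hs.a_pos
      linarith
    refine ⟨ht.V_diag hm', fun j hj1 hj => ?_, hP.matO, hP.matO.isUnit_det_one_add hma,
      fun x hx => LevinsonAlg.System.dominant_removed hs hK hm1 hm' hx,
      (LevinsonAlg.System.inv_ρ_smul_deriv_order hs hm1 hm' hP).matO,
      ((LevinsonAlg.System.inv_ρ_smul_deriv_order hs hm1 hm'
        (LevinsonAlg.System.Qtmat_order hs hm1 ht hm')).matO.mono (by linarith)),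
      (LevinsonAlg.System.Umat_order hs hm1 ht hm').matO,
      (LevinsonAlg.System.Tbar_order hs hm1 ht hm').matO,
      (LevinsonAlg.System.Ttil_order hs hm1 ht hm').matO,
      (LevinsonAlg.System.Tmat_order ht hm').matO⟩
    have h := (ht.V_order j hj1 hj).matO
    rwa [Nat.cast_sub (by omega), Nat.cast_add, Nat.cast_one] at h
  · exact ⟨LevinsonAlg.System.stage_E_order hs hK hm1 hm,
      fun i => ((LevinsonAlg.System.stageOrder_stage hs hm1 hm).φ_order i).isBigO⟩
  · exact LevinsonAlg.System.isSolution_one_add_P_iff hs hm1 (by omega) hX hu Z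
  · obtain ⟨η, h1, h2⟩ := LevinsonAlg.System.exists_asymptotic_solution hs hX hu hi hd k
    exact ⟨η, h1, h2, LevinsonAlg.System.isSolution_prodP hs hX hu h2⟩
  · obtain ⟨η, h1, h2, h3⟩ :=
      LevinsonAlg.System.exists_asymptotic_solution_norm_le hs hX hu hi hd hdiv hsmall k
    exact ⟨η, h1, h2, h3, LevinsonAlg.System.isSolution_prodP hs hX hu h3⟩
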